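/- \textbf{Setting.} Let $G=(V,E,w)$ be a finite undirected simple graph with $n=|V|\ge 1$ vertices and positive real edge weights. Paths may repeat vertices; the weight $w(P)$ of a path $P$ is the sum of the weights of its edges (with multiplicity). Let $d_G(u,v)\in[0,\infty]$ be the minimum weight of a $u$–$v$ path, and let $d_G^{(b)}(u,v)\in[0,\infty]$ be the minimum weight of a $u$–$v$ path with at most $b$ edges (hops), $b\ge 0$ real; the value is $\infty$ if there is no such path. A subgraph $H$ of $G$ is $h$-\emph{respecting} if $d_G^{(h)}(u,v)\le d_H(u,v)$ for all vertices $u,v$ of $H$; a path is $h$-respecting if the subgraph formed by its vertices and edges is. An \emph{ultrametric} is a finite metric space $(U,d_U)$, where the distance $\infty$ is allowed, such that $d_U(x,z)\le\max\{d_U(x,y),d_U(y,z)\}$ for all $x,y,z$. A \emph{clan embedding} of $G$ into $U$ is a pair $(f,\chi)$, where $f$ maps the vertices of $G$ to pairwise disjoint non-empty subsets of $U$, $\chi:V\to U$ satisfies $\chi(v)\in f(v)$ for all $v$, and $d_G(u,v)\le d_U(u',v')$ for all $u,v\in V$, $u'\in f(u)$, $v'\in f(v)$. It has \emph{hop-distortion}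 $(t,\beta,h)$ if for all $u,v\in V$ $$d_G^{(\beta h)}(u,v)\le\min_{u'\in f(u),\,v'\in f(v)}d_U(u',v')\qquad\text{and}\qquad \min_{v'\in f(v)}d_U(v',\chi(u))\le t\cdot d_G^{(h)}(u,v).$$ It has \emph{hop-path-distortion} $(t,h)$ if for every $h$-respecting path $(v_0,\dots,v_m)$ of $G$ there are $v_i'\in f(v_i)$, $0\le i\le m$, with $\sum_{i=0}^{m-1}d_U(v_i',v_{i+1}')\le t\cdot\sum_{i=0}^{m-1}w(v_i,v_{i+1})$. \textbf{Theorem.} There is an absolute constant $C>0$, and for every $a\in\mathbb N$ there is a constant $B=B(a)>0$, such that the following holds for every such graph $G$ with aspect ratio $\frac{\max_{e\in E}w(e)}{\min_{e\in E}w(e)}\le n^{a}$ (no condition if $E=\emptyset$) and every integer $1\le h\le n$. (1) For every integer $1\le k\le n$ there is a (discrete) probability distribution $\mathcal D$ over clan embeddings $(f,\chi)$ of $G$ into ultrametrics such that every $(f,\chi)\in\mathrm{supp}(\mathcal D)$ has hop-distortion $(C k,\;B k\log n,\;h)$ and hop-path-distortion $(C k\log n,\;h)$, and $\mathbb E_{(f,\chi)\sim\mathcal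 D}[|f(v)|]\le C\,n^{1/k}$ for every $v\in V$. (2) For every real $\epsilon\in(0,1)$ there is a (discrete) probability distribution $\mathcal D$ over clan embeddings $(f,\chi)$ of $G$ into ultrametrics such that every $(f,\chi)\in\mathrm{supp}(\mathcal D)$ has hop-distortion $\left(C\frac{\log n}{\epsilon},\;B\frac{\log^2 n}{\epsilon},\;h\right)$ and hop-path-distortion $\left(C\frac{\log^2 n}{\epsilon},\;h\right)$, and $\mathbb E_{(f,\chi)\sim\mathcal D}[|f(v)|]\le 1+\epsilon$ for every $v\in V$. -/

import Mathlib

open scoped ENNReal NNReal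

universe u

noncomputable section

/-- The weight of a walk: the sum of the weights of its edges, counted with multiplicity. -/
def walkWeight {V : Type*} {G : SimpleGraph V} (w : Sym2 V → ℝ≥0) {u v : V} (p : G.Walk u v) :
    ℝ≥0 :=
  (p.edges.map w).sum

/-- The `h`-hop distance: the minimum weight of a `u`-`v` walk with at most `h` edges,
and `∞` if there is none. -/
def hopDist {V : Type*} (G : SimpleGraph V) (w : Sym2 V → ℝ≥0) (h : ℕ) (u v : V) : ℝ≥0∞ :=
  ⨅ (p : G.Walk u v) (_ : p.length ≤ h), (walkWeight w p : ℝ≥0∞)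

/-- The shortest path distance, `∞` between different connected components. -/
def graphDist {V : Type*} (G : SimpleGraph V) (w : Sym2 V → ℝ≥0) (u v : V) : ℝ≥0∞ :=
  ⨅ p : G.Walk u v, (walkWeight w p : ℝ≥0∞)

/-- The ratio between any two edge weights of `G` is at most `R`. -/
def AspectRatioLE {V : Type*} (G : SimpleGraph V) (w : Sym2 V → ℝ≥0) (R : ℝ≥0) : Prop :=
  ∀ e ∈ G.edgeSet, ∀ e' ∈ G.edgeSet, w e ≤ R * w e'

/-- A subgraph `H` of `G` is `h`-respecting if the `h`-hop distance in `G` between any two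
vertices of `H` is at most their shortest path distance in `H`. -/
def IsHopRespecting {V : Type*} (G : SimpleGraph V) (w : Sym2 V → ℝ≥0) (h : ℕ)
    (H : G.Subgraph) : Prop :=
  ∀ u ∈ H.verts, ∀ v ∈ H.verts, hopDist G w h u v ≤ graphDist H.spanningCoe w u v

/-- A clan embedding `(f, χ)` of the weighted graph `(G, w)` into a finite ultrametric space `U`,
in which the distance `∞` is allowed (as it is for `graphDist` and `hopDist`):
a dominating one-to-many embedding `f` together with a chief `χ v ∈ f v` for every vertex `v`. -/
structure UltrametricClanEmbedding {V : Type u} (G : SimpleGraph V) (w : Sym2 V → ℝ≥0) where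
  /-- The points of the ultrametric. -/
  U : Type u
  [finite : Finite U]
  [metric : EMetricSpace U]
  ultra : ∀ x y z : U, edist x z ≤ max (edist x y) (edist y z)
  /-- The clan of a vertex: the set of its copies. -/
  f : V → Finset U
  nonempty : ∀ v, (f v).Nonempty
  disjoint : ∀ u v, u ≠ v → Disjoint (f u) (f v)
  dominating : ∀ u v, ∀ u' ∈ f u, ∀ v' ∈ f v, graphDist G w u v ≤ edist u' v'
  /-- The chief of the clan of a vertex. -/
  χ : V → U
  chief_mem : ∀ v, χ v ∈ f v

attribute [instance] UltrametricClanEmbedding.finite UltrametricClanEmbedding.metric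

namespace UltrametricClanEmbedding

variable {V : Type u} {G : SimpleGraph V} {w : Sym2 V → ℝ≥0}

/-- Hop-distortion `(t, β, h)`. A number of hops is at most the real number `β * h ≥ 0` if and
only if it is at most `⌊β * h⌋₊`. -/
def HasHopDistortion (F : UltrametricClanEmbedding G w) (t β : ℝ) (h : ℕ) : Prop :=
  (∀ u v, ∀ u' ∈ F.f u, ∀ v' ∈ F.f v, hopDist G w ⌊β * h⌋₊ u v ≤ edist u' v') ∧
  (∀ u v, ∃ v' ∈ F.f v, edist v' (F.χ u) ≤ ENNReal.ofReal t * hopDist G w h u v)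

/-- Hop-path-distortion `(t, h)`: every `h`-respecting path `v₀, …, vₘ` of `G` (vertices may
repeat) has copies `c i ∈ f (vᵢ)` such that the path through these copies has length at most
`t` times the weight of the given path. -/
def HasHopPathDistortion (F : UltrametricClanEmbedding G w) (t : ℝ) (h : ℕ) : Prop :=
  ∀ (a b : V) (p : G.Walk a b), IsHopRespecting G w h p.toSubgraph →
    ∃ c : ℕ → F.U, (∀ i ≤ p.length, c i ∈ F.f (p.getVert i)) ∧
      ∑ i ∈ Finset.range p.length, edist (c i) (c (i + 1)) ≤
        ENNReal.ofReal t * (walkWeight w p : ℝ≥0∞)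

end UltrametricClanEmbedding

/-- The expected size of the clan of `v` under a distribution over clan embeddings. -/
def expectedClanSize {V : Type u} {G : SimpleGraph V} {w : Sym2 V → ℝ≥0}
    (D : PMF (UltrametricClanEmbedding G w)) (v : V) : ℝ≥0∞ :=
  ∑' F, D F * ((F.f v).card : ℝ≥0∞)

end

/-! By minimax (`exists_pmf_of_forall_measure`) it suffices to find, for each probability measure on
the vertices, one embedding whose average clan size is small. It comes from ball growing with
overlap, from the top scale down. In a cluster, the ball around a centre is widened in `2 * k`
padding steps, and some two consecutive steps multiply its mass by at most the `k`-th root of the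
total growth. The larger ball becomes a child cluster, the complement of the smaller one is split
further at the same scale, and the shell between them is copied to both sides. The chief of a vertex
goes to the side containing its whole padded neighbourhood, which gives stretch `O(k)`. The growth
factors telescope over the scales, so the copies cost only one `k`-th root in total
(`exists_good_step`).

Hop distances satisfy the triangle inequality only if hop budgets add up, so the budget of a ball
grows by `h` with each padding step. There are `2 * k` steps at each of `O(log n)` scales, whence
the hop blow-up.

A path is cut whenever it leaves the padded neighbourhood of the start of the current piece, and
each cut is charged to the edges of that piece (`Good.greedy`). Apart from a geometric series, an
edge is charged only at the `O(log n)` scales between its weight and `2 * n` times its weight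
(`sum_charge_le`); this is the extra logarithm in the path distortion. -/

noncomputable section

/-! ### Clan systems and their gluing -/

/-- A family of finite sets of copies in a finite ultrametric, given by a bare distance function,
with one distinguished point for every vertex. -/
structure ClanSystem (V : Type u) where
  U : Type u
  finite : Finite U
  ρ : U → U → ℝ≥0∞
  ρ_self : ∀ x, ρ x x = 0
  ρ_comm : ∀ x y, ρ x y = ρ y x
  eq_of_ρ : ∀ x y, ρ x y = 0 → x = y
  ρ_ultra : ∀ x y z, ρ x z ≤ max (ρ x y) (ρ y z)
  f : V → Finset U
  χ : V → U
  disjoint : ∀ u v, u ≠ v → Disjoint (f u) (f v)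

namespace ClanSystem

variable {V : Type u}

open Classical in
/-- The disjoint union of two clan systems, at distance `D` from each other. The chief of `v` is
taken from the first one if `P v` holds and from the second one otherwise. -/
def glue (F F' : ClanSystem V) (D : ℝ≥0∞) (hD : D ≠ 0) (hF : ∀ x y, F.ρ x y ≤ D)
    (hF' : ∀ x y, F'.ρ x y ≤ D) (P : V → Prop) : ClanSystem V where
  U := F.U ⊕ F'.U
  finite := by
    have := F.finite
    have := F'.finite
    infer_instance
  ρ
    | .inl x, .inl y => F.ρ x y
    | .inr x, .inr y => F'.ρ x y
    | _, _ => D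
  ρ_self := by
    rintro (x | x)
    · exact F.ρ_self x
    · exact F'.ρ_self x
  ρ_comm := by
    rintro (x | x) (y | y)
    · exact F.ρ_comm x y
    · rfl
    · rfl
    · exact F'.ρ_comm x y
  eq_of_ρ := by
    rintro (x | x) (y | y) h
    · exact congrArg _ (F.eq_of_ρ x y h)
    · exact absurd h hD
    · exact absurd h hD
    · exact congrArg _ (F'.eq_of_ρ x y h)
  ρ_ultra := by
    rintro (x | x) (y | y) (z | z)
    · exact F.ρ_ultra x y z
    · exact le_max_right _ _
    · exact (hF x z).trans (le_max_left _ _)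
    · exact le_max_left _ _
    · exact le_max_left _ _
    · exact (hF' x z).trans (le_max_left _ _)
    · exact le_max_right _ _
    · exact F'.ρ_ultra x y z
  f v := (F.f v).disjSum (F'.f v)
  χ v := if P v then .inl (F.χ v) else .inr (F'.χ v)
  disjoint u v huv := by
    rw [Finset.disjoint_left]
    rintro (x | x) hu hv
    · rw [Finset.inl_mem_disjSum] at hu hv
      exact Finset.disjoint_left.1 (F.disjoint u v huv) hu hv
    · rw [Finset.inr_mem_disjSum] at hu hv
      exact Finset.disjoint_left.1 (F'.disjoint u v huv) hu hv

open Classical in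
/-- The clan system with a single point, which is the copy of the vertex in `X`. -/
def point (X : Finset V) (hX : ∀ u ∈ X, ∀ v ∈ X, u = v) : ClanSystem V where
  U := PUnit
  finite := inferInstance
  ρ _ _ := 0
  ρ_self _ := rfl
  ρ_comm _ _ := rfl
  eq_of_ρ _ _ _ := rfl
  ρ_ultra _ _ _ := zero_le
  f v := if v ∈ X then {PUnit.unit} else ∅
  χ _ := PUnit.unit
  disjoint u v huv := by
    by_cases hu : u ∈ X
    · have hv : v ∉ X := fun hv => huv (hX u hu v hv)
      simp [hv]
    · simp [hu]

/-- The number of copies, weighted by `μ`. -/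
def cost [Fintype V] (F : ClanSystem V) (μ : V → ℝ) : ℝ := ∑ v, μ v * (F.f v).card

lemma cost_glue [Fintype V] (F F' : ClanSystem V) (D : ℝ≥0∞) (hD : D ≠ 0)
    (hF : ∀ x y, F.ρ x y ≤ D) (hF' : ∀ x y, F'.ρ x y ≤ D) (P : V → Prop) (μ : V → ℝ) :
    (glue F F' D hD hF hF' P).cost μ = F.cost μ + F'.cost μ := by
  simp only [cost, glue, Finset.card_disjSum, Nat.cast_add, mul_add, Finset.sum_add_distrib]

end ClanSystem

/-! ### Abstract hierarchies and the invariants of the construction -/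

/-- The data of a hierarchical decomposition with `S` stages: a distance `d` to be approximated
from above up to the factor `t`, a distance `dA` to be dominated, and for every stage a
neighbourhood relation and a growing sequence of balls around every vertex. -/
structure Hierarchy (V : Type u) (S k : ℕ) (t : ℝ≥0∞) where
  near : ℕ → V → V → Prop
  near_self : ∀ i u, near i u u
  near_symm : ∀ i u v, near i u v → near i v u
  ball : ℕ → ℕ → V → V → Prop
  ball_self : ∀ i j x, ball i j x x
  ball_near : ∀ i j x u v, ball i j x u → near i u v → ball i (j + 1) x v
  ball_top : ∀ i x u, ball i (2 * k) x u → ball (i + 1) 0 x u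
  d : V → V → ℝ≥0∞
  dA : V → V → ℝ≥0∞
  D : ℕ → ℝ≥0∞
  D_zero : D 0 ≠ 0
  D_mono : Monotone D
  dA_le : ∀ i < S, ∀ x u v, ball i (2 * k) x u → ball i (2 * k) x v → dA u v ≤ D i
  D_le : ∀ i < S, ∀ u v, ¬ near i u v → D (i + 1) ≤ t * d u v
  dA_self : ∀ u, dA u u = 0
  eq_of_dA : ∀ u v, dA u v ≤ D 0 → u = v

namespace Hierarchy

variable {V : Type u} {S k : ℕ} {t : ℝ≥0∞} (Q : Hierarchy V S k t)

lemma ball_succ {i j : ℕ} {x u : V} (h : Q.ball i j x u) : Q.ball i (j + 1) x u :=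
  Q.ball_near i j x u u h (Q.near_self i u)

lemma ball_mono {i j l : ℕ} (hjl : j ≤ l) {x u : V} (h : Q.ball i j x u) : Q.ball i l x u := by
  induction l, hjl using Nat.le_induction with
  | base => exact h
  | succ l _ ih => exact Q.ball_succ ih

/-- A charge `ω i j` on the steps `j` of the sequence `c 0, …, c m` at every stage `i` that pays
for every pair of points of the sequence that are not near each other at stage `i`. -/
def IsCharge (m : ℕ) (c : ℕ → V) (ω : ℕ → ℕ → ℝ≥0∞) : Prop :=
  ∀ i < S, ∀ p q, p ≤ q → q ≤ m → ¬ Q.near i (c p) (c q) →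
    Q.D (i + 1) ≤ ∑ j ∈ Finset.Ico p q, ω i j

/-- The clan system `F` on `X` has diameter at most `D e`, dominates `dA`, approximates `d`, and
follows every sequence in `X` whose points are `R`-related to its first point, at the cost of the
first `l` stages. -/
structure Good (e l : ℕ) (R : V → V → Prop) (X : Finset V) (F : ClanSystem V) : Prop where
  mem : ∀ v, ∀ x ∈ F.f v, v ∈ X
  chief : ∀ v ∈ X, F.χ v ∈ F.f v
  diam : ∀ x y, F.ρ x y ≤ Q.D e
  dom : ∀ u v, ∀ x ∈ F.f u, ∀ y ∈ F.f v, Q.dA u v ≤ F.ρ x y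
  close : ∀ u ∈ X, ∀ v ∈ X, ∃ y ∈ F.f v, F.ρ y (F.χ u) ≤ t * Q.d u v
  path : ∀ m c ω, Q.IsCharge m c ω → ∀ p q, p ≤ q → q ≤ m →
    (∀ j, p ≤ j → j ≤ q → c j ∈ X) → (∀ j, p ≤ j → j ≤ q → R (c p) (c j)) →
    ∃ c' : ℕ → F.U, (∀ j, p ≤ j → j ≤ q → c' j ∈ F.f (c j)) ∧
      ∑ j ∈ Finset.Ico p q, F.ρ (c' j) (c' (j + 1)) ≤
        ∑ i ∈ Finset.range l, ∑ j ∈ Finset.Ico p q, ω i j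

variable {Q}

lemma good_point {X : Finset V} (hX : ∀ u ∈ X, ∀ v ∈ X, u = v) (e l : ℕ) (R : V → V → Prop) :
    Q.Good e l R X (ClanSystem.point X hX) := by
  have hmem : ∀ v ∈ X, PUnit.unit ∈ (ClanSystem.point X hX).f v := fun v hv => by
    rw [show (ClanSystem.point X hX).f v = {PUnit.unit} from if_pos hv]
    exact Finset.mem_singleton_self _
  have hmem' : ∀ v, ∀ x ∈ (ClanSystem.point X hX).f v, v ∈ X := fun v x hx => by
    by_contra h
    rw [show (ClanSystem.point X hX).f v = ∅ from if_neg h] at hx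
    exact Finset.notMem_empty _ hx
  refine ⟨hmem', hmem, fun _ _ => zero_le, fun u v x hx y hy => ?_, fun u _ v hv =>
    ⟨PUnit.unit, hmem v hv, zero_le⟩, fun m c ω _ p q _ _ hc _ =>
    ⟨fun _ => PUnit.unit, fun j h h' => hmem _ (hc j h h'), ?_⟩⟩
  · rw [hX u (hmem' u x hx) v (hmem' v y hy), Q.dA_self]
    exact zero_le
  · simp [ClanSystem.point]

/-- Greedy splitting: a sequence in `X` is cut whenever it leaves the neighbourhood of the
starting point of the current piece. -/
lemma Good.greedy {i : ℕ} (hi : i < S) {X : Finset V} {F : ClanSystem V}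
    (hF : Q.Good (i + 1) i (Q.near i) X F) :
    Q.Good (i + 1) (i + 1) (fun _ _ => True) X F := by
  refine ⟨hF.mem, hF.chief, hF.diam, hF.dom, hF.close, ?_⟩
  intro m c ω hω p q hpq hqm hc _
  induction hN : q - p using Nat.strong_induction_on generalizing p with
  | _ N ih =>
  subst hN
  by_cases hall : ∀ j, p ≤ j → j ≤ q → Q.near i (c p) (c j)
  · obtain ⟨c', h1, h2⟩ := hF.path m c ω hω p q hpq hqm hc hall
    refine ⟨c', h1, h2.trans ?_⟩
    rw [Finset.sum_range_succ]
    exact le_self_add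
  · push Not at hall
    classical
    have hex : ∃ j, p ≤ j ∧ j ≤ q ∧ ¬ Q.near i (c p) (c j) := hall
    obtain ⟨hs1, hs2, hs3⟩ := Nat.find_spec hex
    have hmin : ∀ j, j < Nat.find hex → p ≤ j → j ≤ q → Q.near i (c p) (c j) := by
      intro j hj h1 h2
      by_contra h3
      exact Nat.find_min hex hj ⟨h1, h2, h3⟩
    generalize Nat.find hex = s at hs1 hs2 hs3 hmin
    have hps : p < s := lt_of_le_of_ne hs1 (by rintro rfl; exact hs3 (Q.near_self _ _))
    obtain ⟨r, rfl⟩ : ∃ r, s = r + 1 := ⟨s - 1, by omega⟩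
    obtain ⟨c₁, h11, h12⟩ := hF.path m c ω hω p r (by omega) (by omega)
      (fun j h h' => hc j h (by omega)) (fun j h h' => hmin j (by omega) h (by omega))
    obtain ⟨c₂, h21, h22⟩ := ih (q - (r + 1)) (by omega) (r + 1) hs2
      (fun j h h' => hc j (by omega) h') (fun _ _ _ => trivial) rfl
    refine ⟨fun j => if j ≤ r then c₁ j else c₂ j, fun j h h' => ?_, ?_⟩
    · by_cases hj : j ≤ r
      · simpa [hj] using h11 j h hj
      · simpa [hj] using h21 j (by omega) h'
    · have e1 : ∀ g : ℕ → ℝ≥0∞, ∑ j ∈ Finset.Ico p q, g j =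
          (∑ j ∈ Finset.Ico p r, g j + g r) + ∑ j ∈ Finset.Ico (r + 1) q, g j := fun g => by
        rw [← Finset.sum_Ico_succ_top (by omega), Finset.sum_Ico_consecutive g hs1 hs2]
      have e2 : ∑ i' ∈ Finset.range (i + 1), ∑ j ∈ Finset.Ico p q, ω i' j =
          (∑ i' ∈ Finset.range i, ∑ j ∈ Finset.Ico p (r + 1), ω i' j +
            ∑ j ∈ Finset.Ico p (r + 1), ω i j) +
            ∑ i' ∈ Finset.range (i + 1), ∑ j ∈ Finset.Ico (r + 1) q, ω i' j := by
        rw [← Finset.sum_range_succ (fun i' => ∑ j ∈ Finset.Ico p (r + 1), ω i' j),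
          ← Finset.sum_add_distrib]
        refine Finset.sum_congr rfl fun i' _ => ?_
        rw [Finset.sum_Ico_consecutive _ hs1 hs2]
      rw [e1, e2]
      refine add_le_add (add_le_add ?_ ?_) ?_
      · refine le_trans (le_of_eq ?_) (h12.trans ?_)
        · refine Finset.sum_congr rfl fun j hj => ?_
          rw [Finset.mem_Ico] at hj
          dsimp only
          rw [if_pos (by omega), if_pos (by omega)]
        · refine Finset.sum_le_sum fun i' _ => Finset.sum_le_sum_of_subset ?_
          exact Finset.Ico_subset_Ico_right (by omega)
      -- The jump from `r` to `r + 1` costs at most the diameter. It is paid by the stage `i` charge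
      -- on `[p, r + 1)`, which the later pieces do not use.
      · exact (hF.diam _ _).trans (hω i hi p (r + 1) hs1 (by omega) hs3)
      · refine le_trans (le_of_eq ?_) h22
        refine Finset.sum_congr rfl fun j hj => ?_
        rw [Finset.mem_Ico] at hj
        dsimp only
        rw [if_neg (by omega), if_neg (by omega)]

/-- Gluing a good system on a cluster `Y` to one on the remaining vertices. -/
lemma Good.glue {i : ℕ} (hi : i < S) {X Y Z : Finset V} {F F' : ClanSystem V}
    (hF : Q.Good i i (fun _ _ => True) Y F) (hF' : Q.Good (i + 1) i (Q.near i) Z F')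
    (hY : Y ⊆ X) (hZ : Z ⊆ X) (P : V → Prop)
    (hPY : ∀ u ∈ X, P u → ∀ v ∈ X, Q.near i u v → v ∈ Y)
    (hPZ : ∀ u ∈ X, ¬ P u → ∀ v ∈ X, Q.near i u v → v ∈ Z)
    (hX : ∀ u ∈ X, ∀ v ∈ X, Q.dA u v ≤ Q.D (i + 1)) (hD : Q.D (i + 1) ≠ 0)
    (hdF : ∀ x y, F.ρ x y ≤ Q.D (i + 1)) :
    Q.Good (i + 1) i (Q.near i) X (ClanSystem.glue F F' (Q.D (i + 1)) hD hdF hF'.diam P) := by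
  classical
  have hl : ∀ v x, Sum.inl x ∈ (ClanSystem.glue F F' (Q.D (i + 1)) hD hdF hF'.diam P).f v ↔
      x ∈ F.f v := fun v x => Finset.inl_mem_disjSum
  have hr : ∀ v x, Sum.inr x ∈ (ClanSystem.glue F F' (Q.D (i + 1)) hD hdF hF'.diam P).f v ↔
      x ∈ F'.f v := fun v x => Finset.inr_mem_disjSum
  have hχ : ∀ v, P v → (ClanSystem.glue F F' (Q.D (i + 1)) hD hdF hF'.diam P).χ v =
      Sum.inl (F.χ v) := fun v hv => if_pos hv
  have hχ' : ∀ v, ¬ P v → (ClanSystem.glue F F' (Q.D (i + 1)) hD hdF hF'.diam P).χ v =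
      Sum.inr (F'.χ v) := fun v hv => if_neg hv
  have hdiam : ∀ x y, (ClanSystem.glue F F' (Q.D (i + 1)) hD hdF hF'.diam P).ρ x y ≤
      Q.D (i + 1) := by
    rintro (x | x) (y | y)
    exacts [hdF x y, le_rfl, le_rfl, hF'.diam x y]
  have hPY' : ∀ u ∈ X, P u → u ∈ Y := fun u hu h => hPY u hu h u hu (Q.near_self i u)
  have hPZ' : ∀ u ∈ X, ¬ P u → u ∈ Z := fun u hu h => hPZ u hu h u hu (Q.near_self i u)
  have hmem : ∀ v x, x ∈ (ClanSystem.glue F F' (Q.D (i + 1)) hD hdF hF'.diam P).f v → v ∈ X := by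
    rintro v (x | x) hx
    · exact hY (hF.mem v x ((hl v x).1 hx))
    · exact hZ (hF'.mem v x ((hr v x).1 hx))
  have hchief : ∀ v ∈ X, (ClanSystem.glue F F' (Q.D (i + 1)) hD hdF hF'.diam P).χ v ∈
      (ClanSystem.glue F F' (Q.D (i + 1)) hD hdF hF'.diam P).f v := by
    intro v hv
    by_cases h : P v
    · rw [hχ v h]
      exact (hl v _).2 (hF.chief v (hPY' v hv h))
    · rw [hχ' v h]
      exact (hr v _).2 (hF'.chief v (hPZ' v hv h))
  refine ⟨hmem, hchief, hdiam, ?_, ?_, ?_⟩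
  · rintro u v (x | x) hx (y | y) hy
    · exact hF.dom u v x ((hl u x).1 hx) y ((hl v y).1 hy)
    · exact hX u (hmem _ _ hx) v (hmem _ _ hy)
    · exact hX u (hmem _ _ hx) v (hmem _ _ hy)
    · exact hF'.dom u v x ((hr u x).1 hx) y ((hr v y).1 hy)
  · intro u hu v hv
    by_cases hn : Q.near i u v
    · by_cases h : P u
      · obtain ⟨y, hy, hy'⟩ := hF.close u (hPY' u hu h) v (hPY u hu h v hv hn)
        refine ⟨.inl y, (hl v y).2 hy, ?_⟩
        rw [hχ u h]
        exact hy'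
      · obtain ⟨y, hy, hy'⟩ := hF'.close u (hPZ' u hu h) v (hPZ u hu h v hv hn)
        refine ⟨.inr y, (hr v y).2 hy, ?_⟩
        rw [hχ' u h]
        exact hy'
    · exact ⟨_, hchief v hv, (hdiam _ _).trans (Q.D_le i hi u v hn)⟩
  · intro m c ω hω p q hpq hqm hc hn
    have hp := hc p le_rfl hpq
    by_cases h : P (c p)
    · obtain ⟨c', h1, h2⟩ := hF.path m c ω hω p q hpq hqm
        (fun j hj hj' => hPY _ hp h _ (hc j hj hj') (hn j hj hj')) (fun _ _ _ => trivial)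
      exact ⟨fun j => .inl (c' j), fun j hj hj' => (hl _ _).2 (h1 j hj hj'), h2⟩
    · obtain ⟨c', h1, h2⟩ := hF'.path m c ω hω p q hpq hqm
        (fun j hj hj' => hPZ _ hp h _ (hc j hj hj') (hn j hj hj')) hn
      exact ⟨fun j => .inr (c' j), fun j hj hj' => (hr _ _).2 (h1 j hj hj'), h2⟩

end Hierarchy

/-! ### Ball growing with respect to a measure -/

/-- Among `k` consecutive growth factors, one is at most the `k`-th root of their product. -/
lemma exists_growth_le (k : ℕ) (hk : 1 ≤ k) (b : ℕ → ℝ) (hb : ∀ j, 0 < b j) :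
    ∃ j < k, b (j + 1) ≤ b j * (b k / b 0) ^ (1 / (k : ℝ)) := by
  by_contra! h
  set r := (b k / b 0) ^ (1 / (k : ℝ)) with hr
  have hr0 : 0 < r := Real.rpow_pos_of_pos (div_pos (hb k) (hb 0)) _
  have hrk : r ^ k = b k / b 0 := by
    rw [hr, one_div, Real.rpow_inv_natCast_pow (div_pos (hb k) (hb 0)).le (by omega)]
  have key : ∀ j, j < k → b 0 * r ^ (j + 1) < b (j + 1) := by
    intro j
    induction j with
    | zero => intro h0; simpa using h 0 h0
    | succ j ih =>
      intro hj
      calc b 0 * r ^ (j + 1 + 1) = (b 0 * r ^ (j + 1)) * r := by ring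
        _ < b (j + 1) * r := mul_lt_mul_of_pos_right (ih (by omega)) hr0
        _ < b (j + 1 + 1) := h _ hj
  obtain ⟨l, rfl⟩ : ∃ l, k = l + 1 := ⟨k - 1, by omega⟩
  have := key l (by omega)
  rw [hrk, mul_div_cancel₀ _ (hb 0).ne'] at this
  exact lt_irrefl _ this

namespace Hierarchy

variable {V : Type u} [Fintype V] {S k : ℕ} {t : ℝ≥0∞}

open Classical in
-- The centre maximises the mass `b 0` of its innermost ball, so `b 0` can play the role of `M` for
-- the child cluster `Y`. The factor `b k / b 0` lost by the overlap then cancels against `b 0 /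
-- m₀`, and `b k ≤ M` because the widest ball lies in the innermost ball of the next stage. The
-- child is paid for by `b j`, exactly the mass that passing from `X` to `Z` removes.
lemma exists_good_step (Q : Hierarchy V S k t) (hk : 1 ≤ k) (μ : V → ℝ) (m₀ : ℝ) (hm₀ : 0 < m₀)
    (hμ : ∀ v, m₀ ≤ μ v) {i : ℕ} (hi : i < S)
    (ih : ∀ Y : Finset V, (∀ u ∈ Y, ∀ v ∈ Y, Q.dA u v ≤ Q.D i) → ∀ M : ℝ,
      (∀ x ∈ Y, ∑ v ∈ Y with Q.ball i 0 x v, μ v ≤ M) →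
      ∃ F, Q.Good i i (fun _ _ => True) Y F ∧
        F.cost μ ≤ (∑ v ∈ Y, μ v) * (M / m₀) ^ (1 / (k : ℝ)))
    (X : Finset V) (hX : ∀ u ∈ X, ∀ v ∈ X, Q.dA u v ≤ Q.D (i + 1)) (M : ℝ)
    (hM : ∀ x ∈ X, ∑ v ∈ X with Q.ball (i + 1) 0 x v, μ v ≤ M) :
    ∃ F, Q.Good (i + 1) i (Q.near i) X F ∧
      F.cost μ ≤ (∑ v ∈ X, μ v) * (M / m₀) ^ (1 / (k : ℝ)) := by
  have hμ0 : ∀ v, 0 < μ v := fun v => hm₀.trans_le (hμ v)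
  induction X using Finset.strongInduction with
  | H X ihX =>
  rcases X.eq_empty_or_nonempty with rfl | hne
  · refine ⟨_, good_point (by simp) _ _ _, ?_⟩
    simp [ClanSystem.cost, ClanSystem.point]
  obtain ⟨x, hxX, hmax⟩ := X.exists_max_image (fun x => ∑ v ∈ X with Q.ball i 0 x v, μ v) hne
  set b : ℕ → ℝ := fun j => ∑ v ∈ X with Q.ball i (2 * j) x v, μ v with hbdef
  have hb : ∀ j, 0 < b j := fun j => Finset.sum_pos (fun v _ => hμ0 v)
    ⟨x, Finset.mem_filter.2 ⟨hxX, Q.ball_self _ _ _⟩⟩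
  obtain ⟨j, hjk, hj⟩ := exists_growth_le k hk b hb
  set Y := X.filter (fun v => Q.ball i (2 * (j + 1)) x v) with hY
  set Z := X.filter (fun v => ¬ Q.ball i (2 * j) x v) with hZ
  have hYtop : ∀ u ∈ Y, Q.ball i (2 * k) x u := fun u hu =>
    Q.ball_mono (by omega) (Finset.mem_filter.1 hu).2
  have hZX : Z ⊂ X := by
    refine Finset.filter_ssubset.2 ⟨x, hxX, ?_⟩
    simpa using Q.ball_self i (2 * j) x
  have hmonoM : ∀ (W : Finset V) (l : ℕ), W ⊆ X → ∀ y,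
      ∑ v ∈ W with Q.ball l 0 y v, μ v ≤ ∑ v ∈ X with Q.ball l 0 y v, μ v := fun W l hW y =>
    Finset.sum_le_sum_of_subset_of_nonneg (Finset.filter_subset_filter _ hW)
      fun v _ _ => (hμ0 v).le
  have hYX : Y ⊆ X := Finset.filter_subset _ _
  obtain ⟨F, hF, hFc⟩ := ih Y (fun u hu v hv => Q.dA_le i hi x u v (hYtop u hu) (hYtop v hv)) (b 0)
    (fun y hy => (hmonoM Y i hYX y).trans (hmax y (hYX hy)))
  obtain ⟨F', hF', hFc'⟩ := ihX Z hZX (fun u hu v hv => hX u (hZX.1 hu) v (hZX.1 hv))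
    (fun y hy => (hmonoM Z _ hZX.1 y).trans (hM y (hZX.1 hy)))
  have hD : Q.D (i + 1) ≠ 0 := fun h =>
    Q.D_zero (le_antisymm (h ▸ Q.D_mono (Nat.zero_le _)) (zero_le))
  have hdF : ∀ x y, F.ρ x y ≤ Q.D (i + 1) := fun x y =>
    (hF.diam x y).trans (Q.D_mono (Nat.le_succ i))
  -- The middle radius decides the chief: one near-step from inside it stays in the ball of index `2
  -- * (j + 1)`, and one from outside it cannot reach the ball of index `2 * j`.
  refine ⟨_, hF.glue hi hF' hYX hZX.1 (fun u => Q.ball i (2 * j + 1) x u)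
    (fun u _ hPu v hv hn => Finset.mem_filter.2 ⟨hv, Q.ball_near _ _ _ _ _ hPu hn⟩)
    (fun u _ hPu v hv hn => Finset.mem_filter.2 ⟨hv, fun hbv => hPu
      (Q.ball_near _ _ _ _ _ hbv (Q.near_symm _ _ _ hn))⟩) hX hD hdF, ?_⟩
  rw [ClanSystem.cost_glue]
  have hsplit : ∑ v ∈ X, μ v = b j + ∑ v ∈ Z, μ v :=
    (Finset.sum_filter_add_sum_filter_not X _ _).symm
  have hbM : b k ≤ M := by
    refine le_trans ?_ (hM x hxX)
    refine Finset.sum_le_sum_of_subset_of_nonneg (fun v hv => ?_) fun v _ _ => (hμ0 v).le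
    rw [Finset.mem_filter] at hv ⊢
    exact ⟨hv.1, Q.ball_top _ _ _ hv.2⟩
  have hFb : F.cost μ ≤ b j * (M / m₀) ^ (1 / (k : ℝ)) := by
    calc F.cost μ ≤ b (j + 1) * (b 0 / m₀) ^ (1 / (k : ℝ)) := hFc
      _ ≤ (b j * (b k / b 0) ^ (1 / (k : ℝ))) * (b 0 / m₀) ^ (1 / (k : ℝ)) :=
        mul_le_mul_of_nonneg_right hj (Real.rpow_nonneg (div_pos (hb 0) hm₀).le _)
      _ = b j * (b k / m₀) ^ (1 / (k : ℝ)) := by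
        rw [mul_assoc, ← Real.mul_rpow (div_pos (hb k) (hb 0)).le (div_pos (hb 0) hm₀).le,
          div_mul_div_cancel₀ (hb 0).ne']
      _ ≤ b j * (M / m₀) ^ (1 / (k : ℝ)) := by
        refine mul_le_mul_of_nonneg_left (Real.rpow_le_rpow (div_pos (hb k) hm₀).le ?_ ?_)
          (hb j).le
        · exact div_le_div_of_nonneg_right hbM hm₀.le
        · positivity
  rw [hsplit, add_mul]
  exact add_le_add hFb hFc'

open Classical in
theorem exists_good (Q : Hierarchy V S k t) (hk : 1 ≤ k) (μ : V → ℝ) (m₀ : ℝ) (hm₀ : 0 < m₀)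
    (hμ : ∀ v, m₀ ≤ μ v) {i : ℕ} (hi : i ≤ S) :
    ∀ X : Finset V, (∀ u ∈ X, ∀ v ∈ X, Q.dA u v ≤ Q.D i) → ∀ M : ℝ,
      (∀ x ∈ X, ∑ v ∈ X with Q.ball i 0 x v, μ v ≤ M) →
      ∃ F, Q.Good i i (fun _ _ => True) X F ∧
        F.cost μ ≤ (∑ v ∈ X, μ v) * (M / m₀) ^ (1 / (k : ℝ)) := by
  induction i with
  | zero =>
    intro X hX M hM
    have hX' : ∀ u ∈ X, ∀ v ∈ X, u = v := fun u hu v hv => Q.eq_of_dA u v (hX u hu v hv)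
    refine ⟨_, good_point hX' _ _ _, ?_⟩
    have hc : (ClanSystem.point X hX').cost μ = ∑ v ∈ X, μ v := by
      rw [ClanSystem.cost, ← Finset.sum_subset (Finset.subset_univ X)]
      · refine Finset.sum_congr rfl fun v hv => ?_
        simp [ClanSystem.point, hv]
      · intro v _ hv
        simp [ClanSystem.point, hv]
    rw [hc]
    rcases X.eq_empty_or_nonempty with rfl | ⟨x, hx⟩
    · simp
    -- The ball around `x` contains `x`, so `M` is at least `m₀`.
    · refine le_mul_of_one_le_right
        (Finset.sum_nonneg fun v _ => hm₀.le.trans (hμ v)) (Real.one_le_rpow ?_ (by positivity))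
      rw [le_div_iff₀ hm₀, one_mul]
      refine (hμ x).trans (le_trans ?_ (hM x hx))
      exact Finset.single_le_sum (f := μ) (fun v _ => hm₀.le.trans (hμ v))
        (Finset.mem_filter.2 ⟨hx, Q.ball_self _ _ _⟩)
  | succ i ih =>
    intro X hX M hM
    obtain ⟨F, hF, hc⟩ := exists_good_step Q hk μ m₀ hm₀ hμ (Nat.lt_of_succ_le hi)
      (ih (by omega)) X hX M hM
    exact ⟨F, hF.greedy (Nat.lt_of_succ_le hi), hc⟩

end Hierarchy

/-! ### Minimax: from measures to a distribution -/

/-- The minimax principle for a finite set of vectors. -/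
lemma exists_mem_convexHull_le {V : Type*} [Fintype V] [Nonempty V] {A : Set (V → ℝ)}
    (hA : A.Finite) (c : ℝ)
    (h : ∀ μ : V → ℝ, (∀ v, 0 ≤ μ v) → ∑ v, μ v = 1 → ∃ a ∈ A, ∑ v, μ v * a v ≤ c) :
    ∃ y ∈ convexHull ℝ A, ∀ v, y v ≤ c := by
  classical
  by_contra! hcon
  have hdisj : Disjoint (convexHull ℝ A) (Set.Iic fun _ => c) := by
    rw [Set.disjoint_left]
    intro y hy hy'
    obtain ⟨v, hv⟩ := hcon y hy
    exact absurd (hy' v) (not_le.2 hv)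
  obtain ⟨f, s, r, hf1, hsr, hf2⟩ := geometric_hahn_banach_compact_closed
    (convex_convexHull ℝ A) (hA.isCompact_convexHull ℝ) (convex_Iic (fun _ : V => c)) isClosed_Iic
    hdisj
  have hf : ∀ y : V → ℝ, f y = ∑ v, f (Pi.single v 1) * y v := fun y => by
    conv_lhs => rw [← Finset.univ_sum_single y]
    rw [map_sum]
    refine Finset.sum_congr rfl fun v _ => ?_
    have e : Pi.single v (y v) = y v • (Pi.single v 1 : V → ℝ) := by
      rw [← Pi.single_smul, smul_eq_mul, mul_one]
    rw [e, map_smul, smul_eq_mul, mul_comm]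
  set μ : V → ℝ := fun v => - f (Pi.single v 1) with hμdef
  have hfμ : ∀ y : V → ℝ, f y = - ∑ v, μ v * y v := fun y => by
    rw [hf, ← Finset.sum_neg_distrib]
    exact Finset.sum_congr rfl fun v _ => by rw [hμdef]; ring
  -- The orthant is unbounded below in each coordinate, while `f` is bounded below on it; this
  -- forces the signs.
  have hμ : ∀ v, 0 ≤ μ v := by
    intro v
    by_contra! hv
    obtain ⟨K, hK⟩ := exists_nat_gt ((f (fun _ => c) - r) / (- μ v))
    rw [div_lt_iff₀ (by linarith)] at hK
    have hmem : (fun _ => c) + (K : ℝ) • Pi.single v (-1 : ℝ) ∈ Set.Iic fun _ : V => c := by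
      intro x
      by_cases hx : x = v
      · subst hx; simp
      · simp [hx]
    have := hf2 _ hmem
    rw [map_add, map_smul, Pi.single_neg, map_neg, smul_eq_mul] at this
    have e : - f (Pi.single v 1) = μ v := rfl
    rw [e] at this
    linarith
  have hsum : 0 < ∑ v, μ v := by
    refine lt_of_le_of_ne (Finset.sum_nonneg fun v _ => hμ v) fun h0 => ?_
    have hz : ∀ y : V → ℝ, f y = 0 := fun y => by
      rw [hfμ, Finset.sum_eq_zero fun v _ => ?_, neg_zero]
      rw [(Finset.sum_eq_zero_iff_of_nonneg fun v _ => hμ v).1 h0.symm v (Finset.mem_univ v),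
        zero_mul]
    obtain ⟨v⟩ := ‹Nonempty V›
    -- The point mass only serves to show that `A` is non-empty.
    obtain ⟨a, ha, -⟩ := h (Pi.single v 1)
      (fun x => (Pi.single_nonneg.2 zero_le_one : (0 : V → ℝ) ≤ Pi.single v 1) x) (by simp)
    have h1 := hf1 a (subset_convexHull ℝ A ha)
    have h2 := hf2 (fun _ => c) (Set.mem_Iic.2 le_rfl)
    rw [hz] at h1 h2
    linarith
  obtain ⟨a, ha, hac⟩ := h (fun v => μ v / ∑ v, μ v) (fun v => div_nonneg (hμ v) hsum.le)
    (by rw [← Finset.sum_div, div_self hsum.ne'])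
  have h1 := hf1 a (subset_convexHull ℝ A ha)
  have h2 := hf2 (fun _ => c) (Set.mem_Iic.2 le_rfl)
  rw [hfμ] at h1 h2
  rw [← Finset.sum_mul] at h2
  have : ∑ v, μ v * a v ≤ (∑ v, μ v) * c := by
    simp_rw [div_mul_eq_mul_div] at hac
    rw [← Finset.sum_div, div_le_iff₀ hsum] at hac
    linarith
  linarith

/-- If every probability measure on `V` admits a good element with small average count, then some
distribution over good elements has small expected counts at every point of `V`. -/
theorem exists_pmf_of_forall_measure {V : Type*} [Fintype V] [Nonempty V] {α : Type*}
    (N : α → V → ℕ) (good : α → Prop) (K : ℕ) (c : ℝ)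
    (h : ∀ μ : V → ℝ, (∀ v, 0 ≤ μ v) → ∑ v, μ v = 1 →
      ∃ F, good F ∧ (∀ v, N F v ≤ K) ∧ ∑ v, μ v * N F v ≤ c) :
    ∃ D : PMF α, (∀ F ∈ D.support, good F) ∧
      ∀ v, ∑' F, D F * (N F v : ℝ≥0∞) ≤ ENNReal.ofReal c := by
  classical
  set A : Set (V → ℝ) := {a | ∃ F, good F ∧ (∀ v, N F v ≤ K) ∧ a = fun v => (N F v : ℝ)} with hA
  -- The uniform bound `K` leaves finitely many count vectors, although there may be infinitely many
  -- embeddings.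
  have hAfin : A.Finite := by
    refine ((Set.finite_Icc (0 : V → ℕ) (fun _ => K)).image fun b v => (b v : ℝ)).subset ?_
    rintro _ ⟨F, -, hK, rfl⟩
    exact ⟨N F, ⟨fun _ => Nat.zero_le _, hK⟩, rfl⟩
  obtain ⟨y, hy, hyc⟩ := exists_mem_convexHull_le hAfin c fun μ h0 h1 => by
    obtain ⟨F, hg, hK, hc⟩ := h μ h0 h1
    exact ⟨_, ⟨F, hg, hK, rfl⟩, hc⟩
  rw [← hAfin.coe_toFinset, Finset.mem_convexHull'] at hy
  obtain ⟨w, hw0, hw1, hwy⟩ := hy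
  have hmem : ∀ a ∈ hAfin.toFinset, ∃ F, good F ∧ a = fun v => (N F v : ℝ) := fun a ha => by
    obtain ⟨F, hg, -, e⟩ := hAfin.mem_toFinset.1 ha
    exact ⟨F, hg, e⟩
  have hne : Nonempty α := by
    have : hAfin.toFinset.Nonempty := by
      rw [Finset.nonempty_iff_ne_empty]
      intro he
      rw [he] at hw1
      simp at hw1
    obtain ⟨a, ha⟩ := this
    exact ⟨(hmem a ha).choose⟩
  choose! g hg using hmem
  set p : PMF (V → ℝ) := PMF.ofFinset
    (fun a => if a ∈ hAfin.toFinset then ENNReal.ofReal (w a) else 0) hAfin.toFinset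
    (by
      rw [Finset.sum_congr rfl fun a ha => if_pos ha, ← ENNReal.ofReal_sum_of_nonneg hw0, hw1,
        ENNReal.ofReal_one])
    (fun a ha => if_neg ha) with hp
  refine ⟨p.map g, fun F hF => ?_, fun v => ?_⟩
  · obtain ⟨a, ha, rfl⟩ := (PMF.mem_support_map_iff _ _ _).1 hF
    exact (hg a ((PMF.mem_support_ofFinset_iff _ _ _).1 ha).1).1
  · have e : ∑' F, (p.map g) F * (N F v : ℝ≥0∞) = ∑' a, p a * (N (g a) v : ℝ≥0∞) := by
      simp_rw [PMF.map_apply, ← ENNReal.tsum_mul_right]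
      rw [ENNReal.tsum_comm]
      refine tsum_congr fun a => ?_
      rw [tsum_eq_single (g a)]
      · simp
      · intro F hF
        simp [hF]
    rw [e, tsum_eq_sum (s := hAfin.toFinset)]
    · have e2 : ∀ a ∈ hAfin.toFinset,
          p a * (N (g a) v : ℝ≥0∞) = ENNReal.ofReal (w a * a v) := by
        intro a ha
        have ea : a v = (N (g a) v : ℝ) := congrFun (hg a ha).2 v
        rw [hp, PMF.ofFinset_apply, if_pos ha, ENNReal.ofReal_mul (hw0 a ha), ea,
          ENNReal.ofReal_natCast]
      rw [Finset.sum_congr rfl e2, ← ENNReal.ofReal_sum_of_nonneg]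
      · refine ENNReal.ofReal_le_ofReal ?_
        refine le_trans (le_of_eq ?_) (hyc v)
        rw [← hwy, Finset.sum_apply]
        rfl
      · intro a ha
        refine mul_nonneg (hw0 a ha) ?_
        rw [(hg a ha).2]
        positivity
    · intro a ha
      rw [hp, PMF.ofFinset_apply_of_notMem _ _ ha, zero_mul]

/-! ### Hop-constrained distances -/

section HopDist

variable {V : Type*} {G : SimpleGraph V} {w : Sym2 V → ℝ≥0}

lemma hopDist_le_walkWeight {h : ℕ} {u v : V} (p : G.Walk u v) (hp : p.length ≤ h) :
    hopDist G w h u v ≤ walkWeight w p :=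
  iInf₂_le p hp

lemma graphDist_le_walkWeight {u v : V} (p : G.Walk u v) :
    graphDist G w u v ≤ walkWeight w p :=
  iInf_le _ p

lemma graphDist_le_hopDist (h : ℕ) (u v : V) : graphDist G w u v ≤ hopDist G w h u v :=
  le_iInf₂ fun p _ => graphDist_le_walkWeight p

lemma hopDist_self (h : ℕ) (u : V) : hopDist G w h u u = 0 :=
  le_antisymm ((hopDist_le_walkWeight SimpleGraph.Walk.nil (Nat.zero_le _)).trans
    (by simp [walkWeight])) zero_le

lemma hopDist_comm (h : ℕ) (u v : V) : hopDist G w h u v = hopDist G w h v u := by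
  suffices H : ∀ u v, hopDist G w h u v ≤ hopDist G w h v u from le_antisymm (H u v) (H v u)
  intro u v
  refine le_iInf₂ fun p hp => ?_
  refine (hopDist_le_walkWeight p.reverse (by simpa using hp)).trans (le_of_eq ?_)
  simp [walkWeight]

lemma hopDist_anti {h h' : ℕ} (hh : h ≤ h') (u v : V) :
    hopDist G w h' u v ≤ hopDist G w h u v :=
  le_iInf₂ fun p hp => hopDist_le_walkWeight p (hp.trans hh)

lemma hopDist_triangle (h h' : ℕ) (x y z : V) :
    hopDist G w (h + h') x z ≤ hopDist G w h x y + hopDist G w h' y z := by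
  rw [hopDist, hopDist.eq_def G w h x y, hopDist.eq_def G w h' y z]
  refine ENNReal.le_iInf₂_add_iInf₂ fun p hp q hq => ?_
  refine (iInf₂_le (p.append q) (by rw [SimpleGraph.Walk.length_append]; omega)).trans
    (le_of_eq ?_)
  simp [walkWeight]

lemma exists_walk_of_hopDist_ne_top {h : ℕ} {u v : V} (hd : hopDist G w h u v ≠ ⊤) :
    ∃ p : G.Walk u v, p.length ≤ h := by
  by_contra! hp
  refine hd (top_le_iff.1 (le_iInf₂ fun p hle => absurd hle (not_le.2 (hp p))))

lemma List.sum_map_le_length_mul {α : Type*} (l : List α) (g : α → ℝ≥0) (M : ℝ≥0)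
    (h : ∀ a ∈ l, g a ≤ M) : (l.map g).sum ≤ l.length * M := by
  have := List.sum_le_card_nsmul (l.map g) M (by simpa using h)
  simpa using this

/-- Removing cycles from a walk adds no hops and leaves fewer edges than there are vertices. -/
lemma hopDist_le_of_ne_top [Fintype V] {M : ℝ≥0} (hM : ∀ e ∈ G.edgeSet, w e ≤ M)
    {h : ℕ} {u v : V} (hd : hopDist G w h u v ≠ ⊤) :
    hopDist G w h u v ≤ (Fintype.card V * M : ℝ≥0) := by
  classical
  obtain ⟨p, hp⟩ := exists_walk_of_hopDist_ne_top hd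
  refine (hopDist_le_walkWeight p.bypass (p.length_bypass_le_length.trans hp)).trans ?_
  rw [ENNReal.coe_le_coe]
  refine (List.sum_map_le_length_mul _ _ M fun e he =>
    hM e (SimpleGraph.Walk.edges_subset_edgeSet _ he)).trans ?_
  refine mul_le_mul_left ?_ _
  rw [SimpleGraph.Walk.length_edges]
  exact_mod_cast p.bypass_isPath.length_lt.le

lemma le_hopDist_of_ne {m : ℝ≥0} (hm : ∀ e ∈ G.edgeSet, m ≤ w e) (h : ℕ) {u v : V}
    (huv : u ≠ v) : (m : ℝ≥0∞) ≤ hopDist G w h u v := by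
  refine le_iInf₂ fun p _ => ?_
  rw [ENNReal.coe_le_coe]
  cases p with
  | nil => exact absurd rfl huv
  | cons hadj q =>
    rw [walkWeight, SimpleGraph.Walk.edges_cons, List.map_cons, List.sum_cons]
    exact le_add_right (hm _ hadj)

/-- Light edges contribute at most `θ` each, and at most one for every vertex, to a distance. -/
lemma graphDist_le_heavy [Fintype V] {u v : V} (p : G.Walk u v) (θ : ℝ≥0) :
    graphDist G w u v ≤
      ((p.edges.map fun e => if θ ≤ w e then w e else 0).sum + Fintype.card V * θ : ℝ≥0) := by
  classical
  refine (graphDist_le_walkWeight p.bypass).trans ?_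
  rw [ENNReal.coe_le_coe, walkWeight]
  calc (p.bypass.edges.map w).sum
      ≤ (p.bypass.edges.map fun e => (if θ ≤ w e then w e else 0) + θ).sum := by
        refine List.sum_le_sum fun e _ => ?_
        split_ifs with h
        · exact le_self_add
        · rw [zero_add]
          exact (not_le.1 h).le
    _ = (p.bypass.edges.map fun e => if θ ≤ w e then w e else 0).sum +
        p.bypass.length * θ := by
        rw [List.sum_map_add]
        simp
    _ ≤ _ := by
        refine add_le_add ?_ (mul_le_mul_left ?_ _)
        -- The bypass uses a sublist of the edges, so the heavy part does not grow.
        · exact (p.edges_bypass_sublist_edges.map _).sum_le_sum fun _ _ => zero_le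
        · exact_mod_cast p.bypass_isPath.length_lt.le

lemma exists_walk_of_sequence (H : SimpleGraph V) (c : ℕ → V) {a b : ℕ} (hab : a ≤ b)
    (hc : ∀ j, a ≤ j → j < b → H.Adj (c j) (c (j + 1))) :
    ∃ p : H.Walk (c a) (c b), ∀ g : Sym2 V → ℝ≥0,
      (p.edges.map g).sum = ∑ j ∈ Finset.Ico a b, g s(c j, c (j + 1)) := by
  induction b, hab using Nat.le_induction with
  | base => exact ⟨SimpleGraph.Walk.nil, by simp⟩
  | succ b hab ih =>
    obtain ⟨p, hp⟩ := ih fun j h h' => hc j h (by omega)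
    refine ⟨p.concat (hc b hab (by omega)), fun g => ?_⟩
    rw [SimpleGraph.Walk.edges_concat, Finset.sum_Ico_succ_top hab, ← hp g]
    simp

lemma walkWeight_eq_sum {u v : V} (p : G.Walk u v) :
    walkWeight w p = ∑ j ∈ Finset.range p.length, w s(p.getVert j, p.getVert (j + 1)) := by
  induction p with
  | nil => simp [walkWeight]
  | cons hadj q ih =>
    rw [SimpleGraph.Walk.length_cons, Finset.sum_range_succ']
    simp only [SimpleGraph.Walk.getVert_cons_succ, SimpleGraph.Walk.getVert_zero]
    rw [← ih]
    simp [walkWeight, add_comm]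

end HopDist

/-! ### Charges and scales -/

/-- The second term of the minimum carries the induction: if the next scale is at most `w`, so is
the sum of all earlier ones. -/
lemma sum_geometric_le (δ w : ℝ≥0) (N : ℕ) :
    ∑ i ∈ Finset.range N, (if 2 ^ i * δ ≤ w then 2 ^ i * δ else 0) ≤ min (2 * w) (2 ^ N * δ) := by
  induction N with
  | zero => simp
  | succ N ih =>
    rw [Finset.sum_range_succ]
    split_ifs with h
    · have h2 : (2 : ℝ≥0) ^ (N + 1) * δ = 2 ^ N * δ + 2 ^ N * δ := by ring
      rw [h2]
      refine le_min ?_ ?_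
      · rw [two_mul]
        exact add_le_add ((ih.trans (min_le_right _ _)).trans h) h
      · exact add_le_add (ih.trans (min_le_right _ _)) le_rfl
    · rw [add_zero]
      refine ih.trans (min_le_min le_rfl ?_)
      exact mul_le_mul_left (pow_le_pow_right₀ one_le_two (Nat.le_succ N)) _

/-- The total charge of a single edge of weight `w` over all scales `2 ^ i * δ`. -/
lemma sum_charge_le (n : ℕ) (hn : 1 ≤ n) (δ w : ℝ≥0) (N : ℕ) :
    ∑ i ∈ Finset.range N, (if 2 ^ i * δ / (2 * n) ≤ w then min w (2 ^ i * δ) else 0) ≤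
      (Nat.log 2 (2 * n) + 3 : ℕ) * w := by
  -- The scales above `w` at which the edge still counts as heavy; they span a factor of at most `2
  -- * n`.
  set T := (Finset.range N).filter fun i => w < 2 ^ i * δ ∧ 2 ^ i * δ ≤ 2 * n * w with hT
  have hn0 : (0 : ℝ≥0) < 2 * n := by
    have : (0 : ℝ≥0) < n := by exact_mod_cast hn
    positivity
  have hcard : T.card ≤ Nat.log 2 (2 * n) + 1 := by
    rcases T.eq_empty_or_nonempty with h | h
    · simp [h]
    · set i₀ := T.min' h
      have h0 : w < 2 ^ i₀ * δ := (Finset.mem_filter.1 (T.min'_mem h)).2.1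
      have hsub : T ⊆ Finset.Ico i₀ (i₀ + (Nat.log 2 (2 * n) + 1)) := by
        intro i hi
        have h1 : i₀ ≤ i := T.min'_le i hi
        have h2 := (Finset.mem_filter.1 hi).2
        obtain ⟨l, rfl⟩ := Nat.exists_eq_add_of_le h1
        rw [Finset.mem_Ico]
        refine ⟨h1, Nat.add_lt_add_left (Nat.lt_succ_of_le ?_) _⟩
        refine Nat.le_log_of_pow_le one_lt_two ?_
        have hw : 0 < w := by
          by_contra hw
          rw [not_lt, nonpos_iff_eq_zero] at hw
          rw [hw, mul_zero] at h2
          exact absurd h2.1 (not_lt.2 h2.2)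
        have h3 : (2 : ℝ≥0) ^ l * w ≤ 2 * n * w :=
          calc (2 : ℝ≥0) ^ l * w ≤ 2 ^ l * (2 ^ i₀ * δ) := mul_le_mul_right h0.le _
            _ = 2 ^ (i₀ + l) * δ := by ring
            _ ≤ _ := h2.2
        have h4 := le_of_mul_le_mul_right h3 hw
        exact_mod_cast h4
      simpa using Finset.card_le_card hsub
  calc _ ≤ ∑ i ∈ Finset.range N, ((if 2 ^ i * δ ≤ w then 2 ^ i * δ else 0) +
        if w < 2 ^ i * δ ∧ 2 ^ i * δ ≤ 2 * n * w then w else 0) := by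
        refine Finset.sum_le_sum fun i _ => ?_
        by_cases h1 : 2 ^ i * δ ≤ w
        · rw [if_pos h1]
          refine le_add_right ?_
          split_ifs
          · exact min_le_right _ _
          · exact zero_le
        · rw [if_neg h1, zero_add]
          by_cases h2 : 2 ^ i * δ / (2 * n) ≤ w
          · rw [if_pos h2, if_pos ⟨not_le.1 h1, by rwa [div_le_iff₀' hn0] at h2⟩]
            exact min_le_left _ _
          · rw [if_neg h2]
            exact zero_le
    _ ≤ 2 * w + T.card * w := by
        rw [Finset.sum_add_distrib, ← Finset.sum_filter, ← Finset.sum_filter, Finset.sum_const,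
          nsmul_eq_mul, Finset.sum_filter]
        exact add_le_add ((sum_geometric_le δ w N).trans (min_le_left _ _)) le_rfl
    _ ≤ 2 * w + (Nat.log 2 (2 * n) + 1 : ℕ) * w := by
        gcongr
    _ = _ := by
        push_cast
        ring

/-- The padding radius at stage `i`. -/
def padding (m M : ℝ≥0) (k L i : ℕ) : ℝ≥0 :=
  -- In the application `M` bounds all finite hop distances, so above `L` only pairs at infinite
  -- `h`-hop distance fail to be near.
  if i ≤ L then 2 ^ i * (m / (16 * k)) else M

/-- The radius of the smallest balls at stage `i`. -/
def ballRadius (m M : ℝ≥0) (k L i : ℕ) : ℝ≥0 :=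
  m / 8 + ∑ l ∈ Finset.range i, 2 * k * padding m M k L l

/-- The diameter of the ultrametric at stage `i`. -/
def stageDiam (m : ℝ≥0) (L i : ℕ) : ℝ≥0∞ :=
  if i ≤ L + 1 then (2 ^ i * (m / 2) : ℝ≥0) else ⊤

section Scales

variable {m M : ℝ≥0} {k L i : ℕ}

lemma padding_of_le (h : i ≤ L) : padding m M k L i = 2 ^ i * (m / (16 * k)) := if_pos h

lemma padding_of_lt (h : L < i) : padding m M k L i = M := if_neg (not_le.2 h)

lemma ballRadius_succ :
    ballRadius m M k L (i + 1) = ballRadius m M k L i + 2 * k * padding m M k L i := by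
  rw [ballRadius, Finset.sum_range_succ, ← add_assoc, ballRadius]

/-- The `2 * k` padding steps of a stage add exactly its initial radius, so radii double. -/
lemma ballRadius_of_le (hk : 1 ≤ k) (h : i ≤ L + 1) :
    ballRadius m M k L i = 2 ^ i * (m / 8) := by
  have hk0 : (k : ℝ≥0) ≠ 0 := by
    rw [Nat.cast_ne_zero]
    omega
  induction i with
  | zero => simp [ballRadius]
  | succ i ih =>
    rw [ballRadius_succ, ih (by omega), padding_of_le (by omega)]
    have : 2 * (k : ℝ≥0) * (2 ^ i * (m / (16 * k))) = 2 ^ i * (m / 8) := by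
      field_simp
      ring
    rw [this]
    ring

lemma stageDiam_of_le (h : i ≤ L + 1) : stageDiam m L i = (2 ^ i * (m / 2) : ℝ≥0) := if_pos h

lemma stageDiam_mono : Monotone (stageDiam m L) := by
  intro i j hij
  by_cases hj : j ≤ L + 1
  · rw [stageDiam_of_le hj, stageDiam_of_le (hij.trans hj), ENNReal.coe_le_coe]
    exact mul_le_mul_left (pow_le_pow_right₀ one_le_two hij) _
  · rw [stageDiam, stageDiam, if_neg hj]
    exact le_top

lemma stageDiam_succ_eq (hk : 1 ≤ k) (h : i ≤ L) :
    stageDiam m L (i + 1) = (16 * k * padding m M k L i : ℝ≥0) := by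
  have hk0 : (k : ℝ≥0) ≠ 0 := by
    rw [Nat.cast_ne_zero]
    omega
  rw [stageDiam_of_le (by omega), padding_of_le h, pow_succ]
  congr 1
  field_simp

end Scales

/-! ### The hierarchy of a weighted graph and the charge of a path -/

section Graph

variable {V : Type u} [Fintype V] {G : SimpleGraph V} {w : Sym2 V → ℝ≥0}

/-- The hierarchy of hop-constrained balls of a weighted graph. -/
def hopHierarchy (G : SimpleGraph V) (w : Sym2 V → ℝ≥0) (m M : ℝ≥0) (k L h : ℕ) (hk : 1 ≤ k)
    (hm : 0 < m) (hmw : ∀ e ∈ G.edgeSet, m ≤ w e)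
    (hfin : ∀ h u v, hopDist G w h u v ≠ ⊤ → hopDist G w h u v ≤ M) (hML : M ≤ 2 ^ L * m) :
    Hierarchy V (L + 2) k (16 * k : ℝ≥0) where
  near i u v := hopDist G w h u v ≤ padding m M k L i
  near_self i u := by simp [hopDist_self]
  near_symm i u v huv := by rwa [hopDist_comm]
  ball i j x u := hopDist G w ((2 * k * i + j) * h) x u ≤
    (ballRadius m M k L i + j * padding m M k L i : ℝ≥0)
  ball_self i j x := by simp [hopDist_self]
  ball_near i j x u v hu hv := by
    have e : (2 * k * i + (j + 1)) * h = (2 * k * i + j) * h + h := by ring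
    rw [e]
    refine (hopDist_triangle _ _ x u v).trans ((add_le_add hu hv).trans (le_of_eq ?_))
    rw [← ENNReal.coe_add]
    congr 1
    push_cast
    ring
  ball_top i x u hu := by
    have e : (2 * k * (i + 1) + 0) * h = (2 * k * i + 2 * k) * h := by ring
    rw [e, ballRadius_succ]
    refine hu.trans (le_of_eq ?_)
    congr 1
    push_cast
    ring
  d := hopDist G w h
  dA := hopDist G w (4 * k * (L + 2) * h)
  D := stageDiam m L
  D_zero := by
    rw [stageDiam_of_le (Nat.zero_le _)]
    simpa using hm.ne'
  D_mono := stageDiam_mono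
  dA_le i hi x u v hu hv := by
    -- Two points of a ball are joined through its centre, which doubles both the hop budget and the
    -- radius.
    set H := (2 * k * i + 2 * k) * h with hH
    have hlen : H + H ≤ 4 * k * (L + 2) * h := by
      have : H + H = 4 * k * (i + 1) * h := by rw [hH]; ring
      rw [this]
      exact Nat.mul_le_mul_right _ (Nat.mul_le_mul_left _ (by omega))
    have hd : hopDist G w (4 * k * (L + 2) * h) u v ≤ (2 * ballRadius m M k L (i + 1) : ℝ≥0) := by
      refine (hopDist_anti hlen u v).trans ((hopDist_triangle H H u x v).trans ?_)
      rw [hopDist_comm H u x, two_mul, ENNReal.coe_add, ballRadius_succ]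
      push_cast at hu hv ⊢
      exact add_le_add hu hv
    rw [stageDiam_of_le (by omega)]
    rcases Nat.lt_or_ge L i with h' | h'
    -- Here the radius only shows that the distance is finite; it is then at most `M`, hence at most
    -- the diameter of stage `L + 1`.
    · have hi' : i = L + 1 := by omega
      refine (hfin _ u v (ne_top_of_le_ne_top ENNReal.coe_ne_top hd)).trans ?_
      rw [ENNReal.coe_le_coe, hi']
      refine hML.trans (le_of_eq ?_)
      rw [pow_succ, mul_assoc]
      congr 1
      field_simp
    · refine hd.trans (le_of_eq ?_)
      rw [ballRadius_of_le hk (by omega)]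
      congr 1
      field_simp
      ring
  D_le i hi u v hn := by
    rw [not_le] at hn
    rcases Nat.lt_or_ge L i with h' | h'
    · rw [padding_of_lt h'] at hn
      have htop : hopDist G w h u v = ⊤ := by
        by_contra hne
        exact absurd (hfin h u v hne) (not_le.2 hn)
      rw [htop, ENNReal.mul_top]
      · exact le_top
      · rw [ENNReal.coe_ne_zero]
        have : (k : ℝ≥0) ≠ 0 := by
          rw [Nat.cast_ne_zero]
          omega
        positivity
    · rw [stageDiam_succ_eq (M := M) hk h', ENNReal.coe_mul]
      gcongr
  dA_self u := hopDist_self _ u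
  eq_of_dA u v huv := by
    by_contra hne
    refine absurd ((le_hopDist_of_ne hmw _ hne).trans huv) (not_le.2 ?_)
    rw [stageDiam_of_le (Nat.zero_le _), ENNReal.coe_lt_coe, pow_zero, one_mul]
    exact NNReal.half_lt_self hm.ne'

/-- The charge of the edges of a walk at the different stages. -/
def walkCharge (w : Sym2 V → ℝ≥0) (m M : ℝ≥0) (k L : ℕ) {a b : V} (p : G.Walk a b) (i j : ℕ) :
    ℝ≥0∞ :=
  if i ≤ L then
    (32 * k * (if padding m M k L i / (2 * Fintype.card V) ≤ w s(p.getVert j, p.getVert (j + 1))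
      then min (w s(p.getVert j, p.getVert (j + 1))) (padding m M k L i) else 0) : ℝ≥0)
  else 0

lemma sum_walkCharge_le [Nonempty V] (m M : ℝ≥0) (k L : ℕ) {a b : V} (p : G.Walk a b) :
    ∑ i ∈ Finset.range (L + 2), ∑ j ∈ Finset.Ico 0 p.length, walkCharge w m M k L p i j ≤
      (32 * k * (Nat.log 2 (2 * Fintype.card V) + 3 : ℕ) : ℝ≥0) * (walkWeight w p : ℝ≥0∞) := by
  rw [Finset.sum_comm, walkWeight_eq_sum, ENNReal.ofNNReal_finsetSum, Finset.mul_sum,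
    Finset.range_eq_Ico p.length]
  refine Finset.sum_le_sum fun j _ => ?_
  have e : ∑ i ∈ Finset.range (L + 2), walkCharge w m M k L p i j =
      ∑ i ∈ Finset.range (L + 1), walkCharge w m M k L p i j := by
    rw [Finset.sum_range_succ, walkCharge, if_neg (by omega), add_zero]
  rw [e, ← ENNReal.coe_mul, mul_assoc]
  have h := sum_charge_le (Fintype.card V) Fintype.card_pos (m / (16 * k))
    (w s(p.getVert j, p.getVert (j + 1))) (L + 1)
  refine le_trans (le_of_eq ?_) (ENNReal.coe_le_coe.2 (mul_le_mul_right h (32 * k)))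
  rw [Finset.mul_sum, ENNReal.ofNNReal_finsetSum]
  refine Finset.sum_congr rfl fun i hi => ?_
  have hi' : i ≤ L := by
    rw [Finset.mem_range] at hi
    omega
  rw [walkCharge, if_pos hi', padding_of_le hi']

lemma isCharge_walkCharge [Nonempty V] (m M : ℝ≥0) (k L h : ℕ) (hk : 1 ≤ k)
    (hm : 0 < m) (hmw : ∀ e ∈ G.edgeSet, m ≤ w e)
    (hfin : ∀ h u v, hopDist G w h u v ≠ ⊤ → hopDist G w h u v ≤ M) (hML : M ≤ 2 ^ L * m)
    {a b : V} (p : G.Walk a b) (hp : IsHopRespecting G w h p.toSubgraph) :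
    (hopHierarchy G w m M k L h hk hm hmw hfin hML).IsCharge p.length p.getVert
      (walkCharge w m M k L p) := by
  intro i hi s q hsq hq hn
  change ¬ hopDist G w h _ _ ≤ _ at hn
  rw [not_le] at hn
  change stageDiam m L (i + 1) ≤ _
  have hadj : ∀ j, s ≤ j → j < q → p.toSubgraph.spanningCoe.Adj (p.getVert j) (p.getVert (j + 1)) :=
    fun j _ hj => p.toSubgraph_adj_getVert (by omega)
  obtain ⟨W, hW⟩ := exists_walk_of_sequence p.toSubgraph.spanningCoe p.getVert hsq hadj
  have hresp := hp (p.getVert s) (by simp) (p.getVert q) (by simp)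
  have hlt := lt_of_lt_of_le hn hresp
  rcases Nat.lt_or_ge L i with h' | h'
  -- The path itself makes the distance finite, hence at most `M`: nothing is ever cut at the top
  -- stage.
  · exfalso
    rw [padding_of_lt h'] at hn
    exact absurd (hfin _ _ _ (ne_top_of_le_ne_top ENNReal.coe_ne_top
      (hresp.trans (graphDist_le_walkWeight W)))) (not_le.2 hn)
  set δ := padding m M k L i with hδ
  have hc0 : (Fintype.card V : ℝ≥0) ≠ 0 := by
    rw [Nat.cast_ne_zero]
    exact Fintype.card_ne_zero
  -- With this threshold the light edges account for at most `δ / 2`, so the heavy edges must supply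
  -- the rest of `δ`.
  have hlt2 := lt_of_lt_of_le hlt (graphDist_le_heavy W (δ / (2 * Fintype.card V)))
  have e : (Fintype.card V : ℝ≥0) * (δ / (2 * Fintype.card V)) = δ / 2 := by
    field_simp
  rw [e, hW, ENNReal.coe_lt_coe] at hlt2
  have key : δ / 2 ≤ ∑ j ∈ Finset.Ico s q, (if δ / (2 * Fintype.card V) ≤
      w s(p.getVert j, p.getVert (j + 1))
      then min (w s(p.getVert j, p.getVert (j + 1))) δ else 0) := by
    -- A single edge of weight at least `δ` pays alone; otherwise the truncation at `δ` has no
    -- effect.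
    by_cases hbig : ∃ j ∈ Finset.Ico s q, δ ≤ w s(p.getVert j, p.getVert (j + 1))
    · obtain ⟨j, hj, hjδ⟩ := hbig
      refine le_trans ?_ (Finset.single_le_sum (f := fun j => if δ / (2 * Fintype.card V) ≤
        w s(p.getVert j, p.getVert (j + 1))
        then min (w s(p.getVert j, p.getVert (j + 1))) δ else 0) (fun _ _ => zero_le) hj)
      have h1 : δ / (2 * Fintype.card V) ≤ δ := by
        refine div_le_self zero_le ?_
        have : 1 ≤ 2 * Fintype.card V := by
          have := Fintype.card_pos (α := V)
          omega
        exact_mod_cast this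
      rw [if_pos (h1.trans hjδ), min_eq_right hjδ]
      exact half_le_self zero_le
    · push Not at hbig
      have hsum : ∑ j ∈ Finset.Ico s q, (if δ / (2 * Fintype.card V) ≤
          w s(p.getVert j, p.getVert (j + 1))
          then min (w s(p.getVert j, p.getVert (j + 1))) δ else 0) =
          ∑ j ∈ Finset.Ico s q, (if δ / (2 * Fintype.card V) ≤
          w s(p.getVert j, p.getVert (j + 1))
          then w s(p.getVert j, p.getVert (j + 1)) else 0) :=
        Finset.sum_congr rfl fun j hj => by rw [min_eq_left (hbig j hj).le]
      rw [hsum]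
      by_contra! hcon
      have := add_lt_add_left hcon (δ / 2)
      rw [add_halves] at this
      exact lt_irrefl _ (hlt2.trans this)
  have hcharge : ∑ j ∈ Finset.Ico s q, walkCharge w m M k L p i j =
      ((32 * k * ∑ j ∈ Finset.Ico s q, (if δ / (2 * Fintype.card V) ≤
      w s(p.getVert j, p.getVert (j + 1))
      then min (w s(p.getVert j, p.getVert (j + 1))) δ else 0) : ℝ≥0) : ℝ≥0∞) := by
    rw [Finset.mul_sum, ENNReal.ofNNReal_finsetSum]
    exact Finset.sum_congr rfl fun j _ => by rw [walkCharge, if_pos h']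
  rw [hcharge, stageDiam_succ_eq (M := M) hk h', ENNReal.coe_le_coe]
  calc 16 * k * δ = 32 * k * (δ / 2) := by
        field_simp
        ring
    _ ≤ _ := mul_le_mul_right key _

end Graph

/-! ### From clan systems to clan embeddings -/

namespace ClanSystem

variable {V : Type u}

/-- The extended metric space underlying a clan system. -/
@[reducible]
def emetricSpace (F : ClanSystem V) : EMetricSpace F.U where
  edist := F.ρ
  edist_self := F.ρ_self
  edist_comm := F.ρ_comm
  edist_triangle x y z := (F.ρ_ultra x y z).trans (max_le le_self_add le_add_self)
  eq_of_edist_eq_zero := F.eq_of_ρ _ _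

/-- A clan system with chiefs that dominates the graph distance is a clan embedding. -/
def toClanEmbedding {G : SimpleGraph V} {w : Sym2 V → ℝ≥0} (F : ClanSystem V)
    (hχ : ∀ v, F.χ v ∈ F.f v)
    (hdom : ∀ u v, ∀ x ∈ F.f u, ∀ y ∈ F.f v, graphDist G w u v ≤ F.ρ x y) :
    UltrametricClanEmbedding G w where
  U := F.U
  finite := F.finite
  metric := F.emetricSpace
  ultra := F.ρ_ultra
  f := F.f
  nonempty v := ⟨_, hχ v⟩
  disjoint := F.disjoint
  dominating := hdom
  χ := F.χ
  chief_mem := hχ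

end ClanSystem

namespace UltrametricClanEmbedding

variable {V : Type u} {G : SimpleGraph V} {w : Sym2 V → ℝ≥0} {F : UltrametricClanEmbedding G w}

lemma HasHopDistortion.mono {t t' β β' : ℝ} {h : ℕ} (hF : F.HasHopDistortion t β h) (ht : t ≤ t')
    (hβ : β ≤ β') : F.HasHopDistortion t' β' h := by
  refine ⟨fun u v x hx y hy => (hopDist_anti (Nat.floor_mono ?_) u v).trans (hF.1 u v x hx y hy),
    fun u v => ?_⟩
  · exact mul_le_mul_of_nonneg_right hβ (Nat.cast_nonneg h)
  · obtain ⟨y, hy, hy'⟩ := hF.2 u v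
    exact ⟨y, hy, hy'.trans (mul_le_mul_left (ENNReal.ofReal_le_ofReal ht) _)⟩

lemma HasHopPathDistortion.mono {t t' : ℝ} {h : ℕ} (hF : F.HasHopPathDistortion t h)
    (ht : t ≤ t') : F.HasHopPathDistortion t' h := by
  intro a b p hp
  obtain ⟨c, hc, hc'⟩ := hF a b p hp
  exact ⟨c, hc, hc'.trans (mul_le_mul_left (ENNReal.ofReal_le_ofReal ht) _)⟩

end UltrametricClanEmbedding

/-! ### The embedding for a measure and the resulting distribution -/

section Construction

variable {V : Type u} [Fintype V] {G : SimpleGraph V} {w : Sym2 V → ℝ≥0}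

/-- The deterministic clan embedding for a given probability measure on the vertices. -/
theorem exists_clanEmbedding_of_measure [Nonempty V] (m M : ℝ≥0) (k L h : ℕ) (hk : 1 ≤ k)
    (hm : 0 < m) (hmw : ∀ e ∈ G.edgeSet, m ≤ w e)
    (hfin : ∀ h u v, hopDist G w h u v ≠ ⊤ → hopDist G w h u v ≤ M) (hML : M ≤ 2 ^ L * m)
    (μ : V → ℝ) (hμ0 : ∀ v, 0 ≤ μ v) (hμ1 : ∑ v, μ v = 1) :
    ∃ F : UltrametricClanEmbedding G w,
      (F.HasHopDistortion (16 * k) (4 * k * (L + 2)) h ∧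
        F.HasHopPathDistortion (32 * k * (Nat.log 2 (2 * Fintype.card V) + 3)) h) ∧
      (∀ v, (F.f v).card ≤
        ⌊(Fintype.card V : ℝ) * (2 * (2 * Fintype.card V : ℝ) ^ (1 / (k : ℝ)))⌋₊) ∧
      ∑ v, μ v * (F.f v).card ≤ 2 * (2 * Fintype.card V : ℝ) ^ (1 / (k : ℝ)) - 1 := by
  classical
  have hn : (0 : ℝ) < Fintype.card V := by exact_mod_cast Fintype.card_pos
  set n : ℝ := (Fintype.card V : ℝ) with hn_def
  set Q := hopHierarchy G w m M k L h hk hm hmw hfin hML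
  have hsum : ∑ v, (μ v + 1 / n) = 2 := by
    rw [Finset.sum_add_distrib, hμ1, Finset.sum_const, Finset.card_univ, nsmul_eq_mul, ← hn_def,
      mul_one_div_cancel hn.ne']
    norm_num
  have hpos : ∀ v, 0 ≤ μ v + 1 / n := fun v => add_nonneg (hμ0 v) (by positivity)
  -- Adding the uniform measure keeps every mass at least `1 / n`, at the price of total mass 2; so
  -- `M / m₀` is `2 * n`.
  obtain ⟨F, hF, hc⟩ := Q.exists_good hk (fun v => μ v + 1 / n) (1 / n) (by positivity)
    (fun v => le_add_of_nonneg_left (hμ0 v)) le_rfl Finset.univ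
    (fun u _ v _ => by
      change _ ≤ stageDiam m L (L + 2)
      rw [stageDiam, if_neg (by omega)]
      exact le_top) 2
    (fun x _ => (Finset.sum_le_sum_of_subset_of_nonneg (Finset.filter_subset _ _)
      fun v _ _ => hpos v).trans hsum.le)
  rw [hsum, div_div_eq_mul_div, div_one] at hc
  have hχ : ∀ v, F.χ v ∈ F.f v := fun v => hF.chief v (Finset.mem_univ v)
  have hcard : ∀ v, (1 : ℝ) ≤ (F.f v).card := fun v => by
    exact_mod_cast Finset.card_pos.2 ⟨_, hχ v⟩
  refine ⟨F.toClanEmbedding hχ fun u v x hx y hy =>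
    (graphDist_le_hopDist _ u v).trans (hF.dom u v x hx y hy), ⟨⟨?_, ?_⟩, ?_⟩, ?_, ?_⟩
  · intro u v x hx y hy
    have e : ⌊(4 * k * (L + 2) : ℝ) * h⌋₊ = 4 * k * (L + 2) * h := by
      rw [show (4 * k * (L + 2) : ℝ) * h = ((4 * k * (L + 2) * h : ℕ) : ℝ) by push_cast; ring,
        Nat.floor_natCast]
    rw [e]
    exact hF.dom u v x hx y hy
  · intro u v
    obtain ⟨y, hy, hy'⟩ := hF.close u (Finset.mem_univ u) v (Finset.mem_univ v)
    refine ⟨y, hy, hy'.trans (le_of_eq ?_)⟩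
    congr 1
    rw [← ENNReal.ofReal_coe_nnreal]
    simp
  · intro a b p hp
    obtain ⟨c, h1, h2⟩ := hF.path p.length p.getVert _
      (isCharge_walkCharge m M k L h hk hm hmw hfin hML p hp) 0 p.length (Nat.zero_le _) le_rfl
      (fun _ _ _ => Finset.mem_univ _) (fun _ _ _ => trivial)
    refine ⟨c, fun i hi => h1 i (Nat.zero_le _) hi, ?_⟩
    rw [Finset.range_eq_Ico]
    refine h2.trans ((sum_walkCharge_le m M k L p).trans (le_of_eq ?_))
    congr 1
    rw [← ENNReal.ofReal_coe_nnreal]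
    simp
  · intro v
    refine Nat.le_floor ?_
    have h1 : (1 / n) * (F.f v).card ≤ F.cost fun v => μ v + 1 / n := by
      refine le_trans ?_ (Finset.single_le_sum
        (f := fun v => (μ v + 1 / n) * ((F.f v).card : ℝ))
        (fun v _ => mul_nonneg (hpos v) (Nat.cast_nonneg _)) (Finset.mem_univ v))
      exact mul_le_mul_of_nonneg_right (le_add_of_nonneg_left (hμ0 v)) (Nat.cast_nonneg _)
    have h2 := h1.trans hc
    rw [one_div, inv_mul_le_iff₀ hn] at h2
    exact h2
  · have h1 : (F.cost fun v => μ v + 1 / n) =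
        ∑ v, μ v * (F.f v).card + ∑ v, 1 / n * (F.f v).card := by
      rw [ClanSystem.cost, ← Finset.sum_add_distrib]
      exact Finset.sum_congr rfl fun v _ => add_mul _ _ _
    -- Clans are non-empty, so the added uniform part accounts for at least 1 of the cost.
    -- Subtracting it is what brings the second bound down to `1 + ε`.
    have h2 : 1 ≤ ∑ v, 1 / n * ((F.f v).card : ℝ) := by
      calc (1 : ℝ) = ∑ v : V, 1 / n := by
            rw [Finset.sum_const, Finset.card_univ, nsmul_eq_mul, ← hn_def,
              mul_one_div_cancel hn.ne']
        _ ≤ _ := Finset.sum_le_sum fun v _ => le_mul_of_one_le_right (by positivity) (hcard v)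
    change ∑ v, μ v * (F.f v).card ≤ _
    linarith

/-- The distribution over clan embeddings for the growth parameter `k`. -/
theorem exists_distribution [Nonempty V] (m M : ℝ≥0) (k L h : ℕ) (hk : 1 ≤ k)
    (hm : 0 < m) (hmw : ∀ e ∈ G.edgeSet, m ≤ w e)
    (hfin : ∀ h u v, hopDist G w h u v ≠ ⊤ → hopDist G w h u v ≤ M) (hML : M ≤ 2 ^ L * m) :
    ∃ D : PMF (UltrametricClanEmbedding G w),
      (∀ F ∈ D.support, F.HasHopDistortion (16 * k) (4 * k * (L + 2)) h ∧
        F.HasHopPathDistortion (32 * k * (Nat.log 2 (2 * Fintype.card V) + 3)) h) ∧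
      ∀ v, expectedClanSize D v ≤
        ENNReal.ofReal (2 * (2 * Fintype.card V : ℝ) ^ (1 / (k : ℝ)) - 1) :=
  exists_pmf_of_forall_measure (fun (F : UltrametricClanEmbedding G w) v => (F.f v).card) _ _ _
    fun μ h0 h1 => exists_clanEmbedding_of_measure m M k L h hk hm hmw hfin hML μ h0 h1

lemma exists_minimal_weight (hw : ∀ e ∈ G.edgeSet, 0 < w e) {R : ℝ≥0}
    (hR : AspectRatioLE G w R) :
    ∃ m : ℝ≥0, 0 < m ∧ (∀ e ∈ G.edgeSet, m ≤ w e) ∧ ∀ e ∈ G.edgeSet, w e ≤ R * m := by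
  rcases G.edgeSet.eq_empty_or_nonempty with h | h
  · exact ⟨1, one_pos, by simp [h], by simp [h]⟩
  · obtain ⟨e, he, hmin⟩ := G.edgeSet.toFinite.exists_minimalFor w _ h
    exact ⟨w e, hw e he, fun e' he' => (le_total (w e) (w e')).elim id (hmin he'),
      fun e' he' => hR e' he' e he⟩

/-- On a single vertex there is a clan embedding without any distortion. -/
lemma exists_distribution_of_subsingleton [Subsingleton V] (G : SimpleGraph V)
    (w : Sym2 V → ℝ≥0) (h : ℕ) :
    ∃ D : PMF (UltrametricClanEmbedding G w),
      (∀ F ∈ D.support, ∀ t β : ℝ, F.HasHopDistortion t β h ∧ F.HasHopPathDistortion t h) ∧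
      ∀ v, expectedClanSize D v ≤ 1 := by
  have hsub : ∀ u ∈ (Finset.univ : Finset V), ∀ v ∈ (Finset.univ : Finset V), u = v :=
    fun u _ v _ => Subsingleton.elim u v
  set P := ClanSystem.point (Finset.univ : Finset V) hsub with hP
  have hf : ∀ v, P.f v = {PUnit.unit} := fun v => if_pos (Finset.mem_univ v)
  have hmem : ∀ v, P.χ v ∈ P.f v := fun v => by
    rw [hf]
    exact Finset.mem_singleton_self _
  have hdist : ∀ h u v, hopDist G w h u v = 0 := fun h u v => by
    rw [Subsingleton.elim v u, hopDist_self]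
  refine ⟨PMF.pure (P.toClanEmbedding hmem fun u v x _ y _ =>
    (graphDist_le_hopDist 0 u v).trans ((hdist 0 u v).le.trans zero_le)), ?_, ?_⟩
  · intro F hF t β
    rw [PMF.support_pure, Set.mem_singleton_iff] at hF
    subst hF
    refine ⟨⟨fun u v x _ y _ => (hdist _ u v).le.trans zero_le, fun u v =>
      ⟨_, hmem v, ?_⟩⟩, fun a b p _ => ⟨fun _ => P.χ a, fun i _ => ?_, ?_⟩⟩
    · exact zero_le
    · rw [Subsingleton.elim (p.getVert i) a]
      exact hmem a
    · refine le_trans (le_of_eq ?_) zero_le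
      exact Finset.sum_eq_zero fun _ _ => rfl
  · intro v
    rw [expectedClanSize, tsum_eq_single (P.toClanEmbedding hmem fun u v x _ y _ =>
      (graphDist_le_hopDist 0 u v).trans ((hdist 0 u v).le.trans zero_le))]
    · rw [PMF.pure_apply_self, one_mul]
      change ((P.f v).card : ℝ≥0∞) ≤ 1
      rw [hf]
      exact le_of_eq (by norm_cast)
    · intro F hF
      rw [PMF.pure_apply_of_ne _ _ hF, zero_mul]

end Construction

/-! ### Numerical estimates and the final assembly -/

lemma log_two_le_log {n : ℕ} (hn : 2 ≤ n) : Real.log 2 ≤ Real.log n :=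
  Real.log_le_log two_pos (by exact_mod_cast hn)

lemma clog_pow_add_two_le {n : ℕ} (hn : 2 ≤ n) (a : ℕ) :
    4 * ((Nat.clog 2 (n ^ (a + 1)) : ℝ) + 2) ≤ (6 * a + 24) * Real.log n := by
  have h2 := Real.log_two_gt_d9
  have hl := log_two_le_log hn
  have h1 : 1 < n ^ (a + 1) := Nat.one_lt_pow (by omega) (by omega)
  have h3 := Nat.pow_pred_clog_lt_self one_lt_two h1
  set L := Nat.clog 2 (n ^ (a + 1))
  have h4 : ((L.pred : ℕ) : ℝ) * Real.log 2 ≤ (a + 1 : ℕ) * Real.log n := by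
    rw [← Real.log_pow, ← Real.log_pow]
    refine Real.log_le_log (by positivity) ?_
    exact_mod_cast h3.le
  have h5 : (L : ℝ) ≤ (L.pred : ℕ) + 1 := by
    have : L ≤ L.pred + 1 := by
      rw [Nat.pred_eq_sub_one]
      omega
    exact_mod_cast this
  push_cast at h4
  have h6 : (L.pred : ℝ) * (2 / 3) ≤ (a + 1) * Real.log n :=
    le_trans (mul_le_mul_of_nonneg_left (by linarith) (Nat.cast_nonneg _)) h4
  linarith

lemma log_add_three_le {n : ℕ} (hn : 2 ≤ n) :
    (Nat.log 2 (2 * n) : ℝ) + 3 ≤ 8 * Real.log n := by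
  have h2 := Real.log_two_gt_d9
  have hl := log_two_le_log hn
  have h3 := Nat.pow_log_le_self 2 (x := 2 * n) (by omega)
  set L := Nat.log 2 (2 * n)
  have hn0 : (0 : ℝ) < n := by
    have : 0 < n := by omega
    exact_mod_cast this
  have h4 : (L : ℝ) * Real.log 2 ≤ Real.log 2 + Real.log n := by
    rw [← Real.log_pow, ← Real.log_mul two_ne_zero hn0.ne']
    refine Real.log_le_log (by positivity) ?_
    exact_mod_cast h3
  have h6 : (L : ℝ) * (2 / 3) ≤ Real.log 2 + Real.log n :=
    le_trans (mul_le_mul_of_nonneg_left (by linarith) (Nat.cast_nonneg _)) h4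
  linarith

/-- A growth parameter of order `log n / ε` makes the expected clan sizes at most `1 + ε`. -/
lemma exists_growth_parameter {n : ℕ} (hn : 2 ≤ n) {ε : ℝ} (hε : 0 < ε) (hε1 : ε < 1) :
    ∃ k : ℕ, 1 ≤ k ∧ (k : ℝ) ≤ 8 * (Real.log n / ε) ∧
      2 * (2 * n : ℝ) ^ (1 / (k : ℝ)) - 1 ≤ 1 + ε := by
  have h2 := Real.log_two_gt_d9
  have hl := log_two_le_log hn
  have hn0 : (0 : ℝ) < n := by
    have : 0 < n := by omega
    exact_mod_cast this
  set ℓ := Real.log n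
  have hlog : ε / 3 ≤ Real.log (1 + ε / 2) := by
    have h := Real.one_sub_inv_le_log_of_pos (x := 1 + ε / 2) (by linarith)
    refine le_trans ?_ h
    rw [le_sub_iff_add_le, ← le_sub_iff_add_le', inv_le_iff_one_le_mul₀ (by linarith)]
    nlinarith
  have hlog2n : Real.log (2 * n) = Real.log 2 + ℓ := Real.log_mul two_ne_zero hn0.ne'
  set x := Real.log (2 * n) / Real.log (1 + ε / 2) with hx
  have hx0 : 0 < x := div_pos (by rw [hlog2n]; linarith) (by linarith)
  have hxle : x ≤ 6 * (ℓ / ε) := by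
    rw [hx, hlog2n, div_le_iff₀ (by linarith)]
    calc Real.log 2 + ℓ ≤ 6 * (ℓ / ε) * (ε / 3) := by
          field_simp
          linarith
      _ ≤ _ := by
          refine mul_le_mul_of_nonneg_left hlog ?_
          have : 0 < ℓ := by linarith
          positivity
  have hk : 1 ≤ ⌈x⌉₊ := Nat.ceil_pos.2 hx0
  have hk0 : (0 : ℝ) < (⌈x⌉₊ : ℕ) := by exact_mod_cast hk
  refine ⟨⌈x⌉₊, hk, ?_, ?_⟩
  · have h1 := (Nat.ceil_lt_add_one hx0.le).le
    have h3 : 1 / 2 ≤ ℓ / ε := by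
      rw [le_div_iff₀ hε]
      linarith
    linarith
  · have hpow : (2 * n : ℝ) ^ (1 / ((⌈x⌉₊ : ℕ) : ℝ)) ≤ 1 + ε / 2 := by
      rw [Real.rpow_le_iff_le_log (by positivity) (by linarith), one_div, inv_mul_le_iff₀ hk0]
      exact (div_le_iff₀ (by linarith)).1 (Nat.le_ceil x)
    linarith

/-- `C` is an absolute constant; `B` depends only on the exponent `a` that bounds the aspect
ratio by `n ^ a`. -/
theorem theorem3 :
    ∃ C : ℝ, 0 < C ∧ ∀ a : ℕ, ∃ B : ℝ, 0 < B ∧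
      ∀ (V : Type u) [Fintype V] (G : SimpleGraph V) (w : Sym2 V → ℝ≥0) (n h : ℕ),
        Fintype.card V = n →
        (∀ e ∈ G.edgeSet, 0 < w e) →
        AspectRatioLE G w ((n : ℝ≥0) ^ a) →
        1 ≤ h → h ≤ n →
        (∀ k : ℕ, 1 ≤ k → k ≤ n →
          ∃ D : PMF (UltrametricClanEmbedding G w),
            (∀ F ∈ D.support,
              F.HasHopDistortion (C * k) (B * (k * Real.log n)) h ∧
              F.HasHopPathDistortion (C * (k * Real.log n)) h) ∧
            ∀ v : V, expectedClanSize D v ≤ ENNReal.ofReal (C * (n : ℝ) ^ (1 / (k : ℝ)))) ∧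
        (∀ ε : ℝ, 0 < ε → ε < 1 →
          ∃ D : PMF (UltrametricClanEmbedding G w),
            (∀ F ∈ D.support,
              F.HasHopDistortion (C * (Real.log n / ε)) (B * (Real.log n ^ 2 / ε)) h ∧
              F.HasHopPathDistortion (C * (Real.log n ^ 2 / ε)) h) ∧
            ∀ v : V, expectedClanSize D v ≤ ENNReal.ofReal (1 + ε)) := by
  -- The path distortion is at most `256 * (k * log n)` and the hop factor at most `(6 * a + 24) *
  -- (k * log n)`; the common factor 8 comes from `k ≤ 8 * (log n / ε)`.
  refine ⟨2048, by norm_num, fun a => ⟨8 * (6 * a + 24), by positivity, ?_⟩⟩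
  intro V _ G w n h hn hw hR hh hhn
  have hV : Nonempty V := Fintype.card_pos_iff.1 (by omega)
  -- For `n = 1` the logarithm vanishes, so an embedding with no distortion at all is needed.
  rcases Nat.lt_or_ge n 2 with h1 | h2
  · have hn1 : n = 1 := by omega
    have : Subsingleton V := Fintype.card_le_one_iff_subsingleton.1 (by omega)
    obtain ⟨D, hD, hE⟩ := exists_distribution_of_subsingleton G w h
    refine ⟨fun k hk _ => ⟨D, fun F hF => ⟨(hD F hF _ _).1, (hD F hF _ 0).2⟩,
      fun v => (hE v).trans ?_⟩,
      fun ε hε _ => ⟨D, fun F hF => ⟨(hD F hF _ _).1, (hD F hF _ 0).2⟩, fun v => (hE v).trans ?_⟩⟩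
    · rw [hn1, Nat.cast_one, Real.one_rpow, mul_one]
      exact ENNReal.one_le_ofReal.2 (by norm_num)
    · exact ENNReal.one_le_ofReal.2 (by linarith)
  obtain ⟨m, hm, hmw, hwm⟩ := exists_minimal_weight hw hR
  have hfin : ∀ h u v, hopDist G w h u v ≠ ⊤ →
      hopDist G w h u v ≤ (n * ((n : ℝ≥0) ^ a * m) : ℝ≥0) := fun h u v hd => by
    have := hopDist_le_of_ne_top hwm hd
    rwa [hn] at this
  have hML : (n : ℝ≥0) * ((n : ℝ≥0) ^ a * m) ≤ 2 ^ Nat.clog 2 (n ^ (a + 1)) * m := by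
    rw [← mul_assoc, ← pow_succ']
    refine mul_le_mul_left ?_ m
    exact_mod_cast Nat.le_pow_clog one_lt_two _
  have hhop := clog_pow_add_two_le h2 a
  have hpath := log_add_three_le h2
  have hℓ : 0 < Real.log n := (Real.log_pos one_lt_two).trans_le (log_two_le_log h2)
  have main := fun k hk => exists_distribution (G := G) (w := w) m _ k _ h hk hm hmw hfin hML
  rw [hn] at main
  have hβ : ∀ k : ℕ, 4 * (k : ℝ) * ((Nat.clog 2 (n ^ (a + 1)) : ℝ) + 2) ≤
      (6 * a + 24) * (k * Real.log n) := fun k => by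
    have := mul_le_mul_of_nonneg_left hhop (Nat.cast_nonneg (α := ℝ) k)
    linarith
  have ht : ∀ k : ℕ, 32 * (k : ℝ) * ((Nat.log 2 (2 * n) : ℝ) + 3) ≤
      256 * (k * Real.log n) := fun k => by
    have := mul_le_mul_of_nonneg_left hpath (Nat.cast_nonneg (α := ℝ) k)
    linarith
  refine ⟨fun k hk _ => ?_, fun ε hε hε1 => ?_⟩
  · obtain ⟨D, hD, hE⟩ := main k hk
    have hk0 : (0 : ℝ) ≤ k := Nat.cast_nonneg k
    refine ⟨D, fun F hF => ⟨(hD F hF).1.mono (by linarith) ((hβ k).trans ?_),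
      (hD F hF).2.mono ((ht k).trans ?_)⟩, fun v => (hE v).trans (ENNReal.ofReal_le_ofReal ?_)⟩
    · have : 0 ≤ (6 * a + 24) * (k * Real.log n) := by positivity
      linarith
    · have : 0 ≤ k * Real.log n := by positivity
      linarith
    · have h3 : (2 : ℝ) ^ (1 / (k : ℝ)) ≤ 2 := by
        have hle : 1 / (k : ℝ) ≤ 1 := by
          rw [div_le_one (by exact_mod_cast hk)]
          exact_mod_cast hk
        exact (Real.rpow_le_rpow_of_exponent_le one_le_two hle).trans_eq (Real.rpow_one 2)
      have h4 : (0 : ℝ) ≤ (n : ℝ) ^ (1 / (k : ℝ)) := by positivity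
      rw [Real.mul_rpow two_pos.le (Nat.cast_nonneg n)]
      have := mul_le_mul_of_nonneg_right h3 h4
      linarith
  · obtain ⟨k, hk, hkε, hpow⟩ := exists_growth_parameter h2 hε hε1
    obtain ⟨D, hD, hE⟩ := main k hk
    have hkl : k * Real.log n ≤ 8 * (Real.log n ^ 2 / ε) := by
      have := mul_le_mul_of_nonneg_right hkε hℓ.le
      calc k * Real.log n ≤ _ := this
        _ = _ := by ring
    have hq : 0 ≤ Real.log n / ε := by positivity
    refine ⟨D, fun F hF => ⟨(hD F hF).1.mono (by linarith) ((hβ k).trans ?_),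
      (hD F hF).2.mono ((ht k).trans (by linarith))⟩,
      fun v => (hE v).trans (ENNReal.ofReal_le_ofReal hpow)⟩
    have := mul_le_mul_of_nonneg_left hkl (show (0 : ℝ) ≤ 6 * a + 24 by positivity)
    linarith

end
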